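/- Let $\mathbb T=\mathbb R/2\pi\mathbb Z$, let $\alpha,\beta\in\mathbb R$ with $\alpha\neq 0$, and write $\langle y\rangle=1+|y|$. For $u:\mathbb T\times\mathbb R\to\mathbb C$ in $L^2$ let $\widehat u(k,\tau)=\frac1{(2\pi)^2}\int_{\mathbb R}\int_{\mathbb T}e^{-i(kx+\tau t)}u(x,t)\,dx\,dt$, $k\in\mathbb Z$, $\tau\in\mathbb R$, be its space-time Fourier transform (in the $L^2$ sense), and for $s,b\ge 0$ put $$\|u\|_{X^{s,b}}=\Big(\sum_{k\in\mathbb Z}\int_{\mathbb R}\langle k\rangle^{2s}\,\langle\tau+\alpha k^5-\beta k^3\rangle^{2b}\,|\widehat u(k,\tau)|^2\,d\tau\Big)^{1/2},$$ with $\|u\|_{X^{s,b}}=\infty$ if $u\notin L^2(\mathbb T\times\mathbb R)$. For $\delta\ge 0$ let $\|u\|_{X^{s,b}_\delta}$ be the infimum of $\|\tilde u\|_{X^{s,b}}$ over all $\tilde u$ with $\tilde u=u$ almost everywhere on $\mathbb T\times[0,\delta]$. **Lemma 4.3.** For every $\epsilon>0$ and $b>1/2$ there is a constant $C$, depending only on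 $\alpha,\beta,\epsilon,b$, such that for all $\delta\ge 0$ and all $u:\mathbb T\times\mathbb R\to\mathbb C$, $$\|\chi_{[0,\delta]}(t)\,u\|_{L^6_{t,x}(\mathbb R\times\mathbb T)}\le C\,\|u\|_{X^{\epsilon,b}_\delta}.$$ -/

import Mathlib

open MeasureTheory FourierTransform
open scoped ENNReal NNReal

noncomputable section

namespace Kawahara

instance factTwoPiPos : Fact (0 < 2 * Real.pi) := ⟨Real.two_pi_pos⟩

/-- The torus `ℝ / 2πℤ`. Its `volume` is Lebesgue measure, of total mass `2π`. -/
abbrev Torus : Type := AddCircle (2 * Real.pi)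

/-- The bracket `⟨x⟩ = 1 + |x|`. -/
def bracket (x : ℝ) : ℝ := 1 + |x|

/-- The Fourier transform in `x`: the function of time
`u_k(t) = (1/2π) ∫_0^{2π} e^{-ikx} u(x,t) dx`. -/
def spaceCoeff (u : Torus × ℝ → ℂ) (k : ℤ) (t : ℝ) : ℂ :=
  fourierCoeff (fun x : Torus => u (x, t)) k

/-- The space Fourier coefficients of a function in `L²(𝕋 × ℝ)` are in `L²(ℝ)`. -/
theorem memLp_spaceCoeff {u : Torus × ℝ → ℂ} (hu : MemLp u 2 volume) (k : ℤ) :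
    MemLp (spaceCoeff u k) 2 volume := by
  have hvol : (volume : Measure Torus) =
      ENNReal.ofReal (2 * Real.pi) • AddCircle.haarAddCircle :=
    AddCircle.volume_eq_smul_haarAddCircle
  have hc : ENNReal.ofReal (2 * Real.pi) ≠ 0 := by
    simpa using Real.two_pi_pos
  have hprod : (volume : Measure (Torus × ℝ)) = ENNReal.ofReal (2 * Real.pi) •
      ((AddCircle.haarAddCircle (T := 2 * Real.pi)).prod (volume : Measure ℝ)) := by
    rw [Measure.volume_eq_prod, hvol, Measure.prod_smul_left]
  have hu' : MemLp u 2 ((AddCircle.haarAddCircle (T := 2 * Real.pi)).prod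
      (volume : Measure ℝ)) := by
    refine hu.of_measure_le_smul (c := (ENNReal.ofReal (2 * Real.pi))⁻¹)
      (ENNReal.inv_ne_top.2 hc) ?_
    rw [hprod, smul_smul, ENNReal.inv_mul_cancel hc ENNReal.ofReal_ne_top, one_smul]
  have hmeas : AEStronglyMeasurable (spaceCoeff u k) volume := by
    have h1 : AEStronglyMeasurable (fun z : ℝ × Torus => fourier (-k) z.2 • u (z.2, z.1))
        ((volume : Measure ℝ).prod AddCircle.haarAddCircle) :=
      ((fourier (-k)).continuous.comp continuous_snd).aestronglyMeasurable.smul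
        hu'.1.prod_swap
    exact h1.integral_prod_right'
  refine ⟨hmeas, ?_⟩
  rw [eLpNorm_lt_top_iff_lintegral_rpow_enorm_lt_top (by norm_num) (by norm_num)]
  have hfin := (eLpNorm_lt_top_iff_lintegral_rpow_enorm_lt_top (by norm_num) (by norm_num)).1 hu'.2
  rw [lintegral_prod_symm _ (hu'.1.enorm.pow_const _)] at hfin
  refine lt_of_le_of_lt (lintegral_mono_ae ?_) hfin
  filter_upwards [hu'.1.prodMk_right] with t ht
  have h2 : ‖spaceCoeff u k t‖ₑ ≤
      eLpNorm (fun x : Torus => u (x, t)) 1 AddCircle.haarAddCircle := by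
    rw [eLpNorm_one_eq_lintegral_enorm]
    refine (enorm_integral_le_lintegral_enorm _).trans (le_of_eq ?_)
    refine lintegral_congr fun x => ?_
    rw [enorm_smul]
    have : ‖fourier (-k) x‖ₑ = 1 := by
      rw [← ofReal_norm, fourier_apply, Circle.norm_coe, ENNReal.ofReal_one]
    rw [this, one_mul]
  have h3 := h2.trans (eLpNorm_le_eLpNorm_of_exponent_le (p := 1) (q := 2) (by norm_num) ht)
  rw [eLpNorm_eq_lintegral_rpow_enorm_toReal (by norm_num) (by norm_num)] at h3
  refine (ENNReal.rpow_le_rpow h3 (by norm_num : (0 : ℝ) ≤ (2 : ℝ≥0∞).toReal)).trans ?_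
  rw [← ENNReal.rpow_mul]
  norm_num

/-- The Fourier transform `f̂(τ) = (1/2π) ∫ e^{-iτt} f(t) dt` of `f ∈ L²(ℝ)`, expressed through
the `L²` extension of `𝓕 f ξ = ∫ e^{-2πiξt} f(t) dt`. -/
def timeFourier (f : ℝ → ℂ) (hf : MemLp f 2 volume) (τ : ℝ) : ℂ :=
  (1 / (2 * Real.pi) : ℂ) * (𝓕 (hf.toLp f) : Lp ℂ 2 (volume : Measure ℝ)) (τ / (2 * Real.pi))

/-- The space-time Fourier transform `û(k,τ)` of `u ∈ L²(𝕋 × ℝ)`. -/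
def spaceTimeFourier (u : Torus × ℝ → ℂ) (hu : MemLp u 2 volume) (k : ℤ) (τ : ℝ) : ℂ :=
  timeFourier (spaceCoeff u k) (memLp_spaceCoeff hu k) τ

open scoped Classical in
/-- The Bourgain norm
`‖u‖_{X^{s,b}} = ‖⟨k⟩^s ⟨τ + α k⁵ - β k³⟩^b û(k,τ)‖_{l²_k L²_τ}`, for exponents `s, b ≥ 0`.
For these both weights are at least `1`, so by Plancherel's theorem every element of `X^{s,b}` is in
`L²(𝕋 × ℝ)`; the norm of a function outside `L²` is therefore `∞`. -/
def bourgainNorm (α β s b : ℝ) (u : Torus × ℝ → ℂ) : ℝ≥0∞ :=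
  if hu : MemLp u 2 volume then
    (∑' k : ℤ, ∫⁻ τ : ℝ,
      ENNReal.ofReal (bracket k ^ s * bracket (τ + α * (k : ℝ) ^ 5 - β * (k : ℝ) ^ 3) ^ b *
        ‖spaceTimeFourier u hu k τ‖) ^ 2) ^ (1 / 2 : ℝ)
  else ∞

/-- The restricted norm `‖u‖_{X_δ^{s,b}}`: the infimum of `‖v‖_{X^{s,b}}` over all `v` that agree
with `u` (almost everywhere) for times `t ∈ [0,δ]`. It is `∞` if `u` has no extension in
`X^{s,b}`. -/
def restrictedNorm (α β s b δ : ℝ) (u : Torus × ℝ → ℂ) : ℝ≥0∞ :=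
  ⨅ (v : Torus × ℝ → ℂ)
    (_ : ∀ᵐ z ∂(volume : Measure (Torus × ℝ)), z.2 ∈ Set.Icc 0 δ → v z = u z),
    bourgainNorm α β s b v

end Kawahara

end

open MeasureTheory FourierTransform
open scoped ENNReal NNReal

noncomputable section

namespace Kawahara

/-! The time cutoff is harmless: an extension `v` agrees with `u` on `[0,δ]`, and truncation does
not increase an `L⁶` norm, so the matter is a global estimate of `v` by its Bourgain norm
(`eLpNorm_six_le_bourgainNorm`). Cut the time frequencies of the `k`-th space coefficient into unit
intervals according to their distance `m` from the characteristic curve. For fixed `m` the pieces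
are `WavePackets` along a translate of the curve, and Cauchy–Schwarz sums over `m` because `b >
1/2`. It remains to bound the `L⁶` norm of such packets with an arbitrarily small power loss in `k`;
dyadic blocks in `k` reduce this to frequency intervals on which the phase has second derivative of
constant sign and comparable to some `Λ ≥ 1` (`CurvedPhase`).

On these intervals the argument is a bilinear bootstrap in the style of efficient congruencing. Let
`D(R)` be the best constant in `∫|F_S|⁶ ≤ D(R) ‖F_S‖₂⁶` for `S` of diameter `R`. For `S` and `I`
separated by `d`, with `I` of diameter `A`, curvature makes pieces of `S` at distance much more than
`A²/d` orthogonal against the weight `|F_I|⁴` (`CurvedPhase.frequency_gap`). So `S` can be cut to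
length about `A²/d`; Cauchy–Schwarz then exchanges the roles of the two sets, at the price of a
factor `D(A)^(1/2)` (`CurvedPhase.bilinearBound_step`). Repetition squares the ratio `A/d` each time
and gains a power of it.

A broad–narrow decomposition returns from bilinear to linear: either one short piece and its
neighbours dominate, or two separated pieces do (`sixBound_of_bilinearBound`). If `D(R) ≲ R^lam`,
enough bilinear steps improve `lam` by a factor below `1` (`GrowthExponent.improve`), and iteration
from the trivial exponent `5` reaches every positive exponent (`growthExponent_of_pos`). -/

/-! ### Band-limited functions and the inverse Fourier transform. -/

theorem continuous_fourierInv {h : ℝ → ℂ} (hh : Integrable h) : Continuous (𝓕⁻ h) := by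
  have h1 : Continuous (𝓕 h) :=
    VectorFourier.fourierIntegral_continuous Real.continuous_fourierChar (by fun_prop) hh
  have h2 : 𝓕⁻ h = fun t => 𝓕 h (-t) := funext fun t => Real.fourierInv_eq_fourier_neg h t
  rw [h2]
  exact h1.comp continuous_neg

theorem norm_fourierInv_le (h : ℝ → ℂ) (t : ℝ) : ‖(𝓕⁻ h) t‖ ≤ ∫ ξ, ‖h ξ‖ := by
  rw [Real.fourierInv_eq_fourier_neg]
  exact VectorFourier.norm_fourierIntegral_le_integral_norm _ _ _ _ _

/-- `F` is the inverse Fourier transform of an integrable function supported in `[c - r, c + r]`. -/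
def BandLimited (F : ℝ → ℂ) (c r : ℝ) : Prop :=
  ∃ h : ℝ → ℂ, Integrable h ∧ (∀ ξ, r < |ξ - c| → h ξ = 0) ∧ F = 𝓕⁻ h

theorem BandLimited.continuous {F : ℝ → ℂ} {c r : ℝ} (hF : BandLimited F c r) :
    Continuous F := by
  obtain ⟨h, hh, -, rfl⟩ := hF
  exact continuous_fourierInv hh

theorem BandLimited.mul {F G : ℝ → ℂ} {c r c' r' : ℝ} (hF : BandLimited F c r)
    (hG : BandLimited G c' r') : BandLimited (fun t => F t * G t) (c + c') (r + r') := by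
  obtain ⟨f, hf, hfs, rfl⟩ := hF
  obtain ⟨g, hg, hgs, rfl⟩ := hG
  refine ⟨convolution f g (ContinuousLinearMap.mul ℂ ℂ) volume,
    hf.integrable_convolution _ hg, fun ξ hξ => ?_, ?_⟩
  · by_contra hne
    obtain ⟨a, ha, b, hb, rfl⟩ := support_convolution_subset (L := ContinuousLinearMap.mul ℂ ℂ)
      (Function.mem_support.2 hne)
    have h1 : |a - c| ≤ r := by
      by_contra hlt
      exact ha (hfs a (not_le.1 hlt))
    have h2 : |b - c'| ≤ r' := by
      by_contra hlt
      exact hb (hgs b (not_le.1 hlt))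
    have h3 := abs_add_le (a - c) (b - c')
    have h4 : a - c + (b - c') = a + b - (c + c') := by ring
    rw [h4] at h3
    simp only at hξ
    linarith
  · funext t
    simp only [Real.fourierInv_eq_fourier_neg]
    rw [Real.fourier_mul_convolution_eq hf hg]

theorem BandLimited.conj {F : ℝ → ℂ} {c r : ℝ} (hF : BandLimited F c r) :
    BandLimited (fun t => starRingEnd ℂ (F t)) (-c) r := by
  obtain ⟨f, hf, hfs, rfl⟩ := hF
  refine ⟨fun ξ => starRingEnd ℂ (f (-ξ)), ?_, fun ξ hξ => ?_, ?_⟩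
  · have h1 : Integrable (fun ξ => f (-ξ)) := hf.comp_neg
    exact Complex.conjLIE.integrable_comp_iff.2 h1
  · have : r < |(-ξ) - c| := by
      rw [← abs_neg]
      convert hξ using 2
      ring
    simp [hfs _ this]
  · funext t
    rw [Real.fourierInv_eq, Real.fourierInv_eq, ← integral_conj,
      ← integral_neg_eq_self]
    congr 1
    funext ξ
    simp [Circle.smul_def, ← Circle.coe_inv_eq_conj, AddChar.map_neg_eq_inv]

/-- The integral is the value at frequency `0` of the transform. Inversion is needed only at that
point, and there `f` is continuous because it vanishes on an open set containing `0`. -/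
theorem BandLimited.integral_eq_zero {F : ℝ → ℂ} {c r : ℝ} (hF : BandLimited F c r)
    (hint : Integrable F) (hr : r < |c|) : ∫ t, F t = 0 := by
  obtain ⟨f, hf, hfs, rfl⟩ := hF
  have hopen : IsOpen {ξ : ℝ | r < |ξ - c|} := isOpen_lt (by fun_prop) (by fun_prop)
  have hmem : (0 : ℝ) ∈ {ξ : ℝ | r < |ξ - c|} := by simpa using hr
  have hcont : ContinuousAt f 0 := by
    refine (continuousAt_const (y := (0 : ℂ))).congr ?_
    filter_upwards [hopen.mem_nhds hmem] with ξ hξ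
    exact (hfs ξ hξ).symm
  have hint' : Integrable (𝓕 f) := by
    have h1 := hint.comp_neg
    refine h1.congr (Filter.Eventually.of_forall fun t => ?_)
    simp [Real.fourierInv_eq_fourier_neg]
  have h1 := hf.fourier_fourierInv_eq hint' hcont
  rw [hfs 0 hmem, Real.fourier_eq] at h1
  simpa using h1

theorem integral_torus_fourier {n : ℤ} (hn : n ≠ 0) :
    ∫ x : Torus, (fourier n x : ℂ) = 0 := by
  have h1 := fourierCoeff_fourier (T := 2 * Real.pi) n
  have h2 := congrFun h1 0
  rw [fourierCoeff] at h2
  rw [AddCircle.volume_eq_smul_haarAddCircle, integral_smul_measure]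
  simp only [neg_zero, fourier_zero, one_smul] at h2
  rw [h2]
  simp [hn.symm]

/-- The inverse Fourier transform on `L²` is given by the Fourier integral on `L¹ ∩ L²`. -/
theorem fourierInv_toLp_ae_eq {h : ℝ → ℂ} (h1 : Integrable h) (h2 : MemLp h 2 volume) :
    ((𝓕⁻ (h2.toLp h) : Lp ℂ 2 (volume : Measure ℝ)) : ℝ → ℂ) =ᵐ[volume] 𝓕⁻ h := by
  have hloc : LocallyIntegrable
      ((𝓕⁻ (h2.toLp h) : Lp ℂ 2 (volume : Measure ℝ)) : ℝ → ℂ) volume :=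
    (Lp.memLp _).locallyIntegrable (by norm_num)
  -- Test functions are Schwartz, so on them the `L²` transform is known through its tempered
  -- distribution; the multiplication formula then moves the Fourier integral from the test function
  -- to `h`.
  refine ae_eq_of_integral_contDiff_smul_eq hloc
    (continuous_fourierInv h1).locallyIntegrable fun g hg hgc => ?_
  have hg' : ContDiff ℝ (↑(⊤ : ℕ∞)) (fun x => (g x : ℂ)) :=
    Complex.ofRealCLM.contDiff.comp hg
  have hgc' : HasCompactSupport (fun x => (g x : ℂ)) :=
    hgc.comp_left (g := fun r : ℝ => (r : ℂ)) (by simp)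
  let G : SchwartzMap ℝ ℂ := hgc'.toSchwartzMap hg'
  have hG : ∀ x, G x = (g x : ℂ) := fun x => rfl
  have key := congrArg (fun T => T G) (Lp.fourierInv_toTemperedDistribution_eq (h2.toLp h))
  simp only [TemperedDistribution.fourierInv_apply, Lp.toTemperedDistribution_apply] at key
  have e1 : ∫ x, (𝓕⁻ G : SchwartzMap ℝ ℂ) x • (h2.toLp h) x =
      ∫ x, (𝓕⁻ (G : ℝ → ℂ)) x • h x := by
    refine integral_congr_ae ?_
    filter_upwards [h2.coeFn_toLp] with x hx
    rw [hx, SchwartzMap.fourierInv_coe]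
  have e2 : ∫ x, (𝓕⁻ (G : ℝ → ℂ)) x • h x = ∫ x, G x • (𝓕⁻ h) x := by
    have := VectorFourier.integral_fourierIntegral_smul_eq_flip (L := innerₗ ℝ)
      (μ := volume) (ν := volume) Real.continuous_fourierChar (by fun_prop) G.integrable
      (h1.comp_neg)
    have f1 : ∀ x, (𝓕⁻ (G : ℝ → ℂ)) x = 𝓕 (G : ℝ → ℂ) (-x) := Real.fourierInv_eq_fourier_neg _
    rw [← integral_neg_eq_self]
    simp only [f1, neg_neg]
    refine this.trans ?_
    congr 1
    funext x
    congr 1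
    rw [Real.fourierInv_eq_fourier_comp_neg, flip_innerₗ]
    rfl
  have e3 : ∀ f : ℝ → ℂ, ∫ x, g x • f x = ∫ x, G x • f x := fun f => by
    congr 1
  rw [e3, e3, ← e2, ← e1, key]

/-! ### Wave packets and the vanishing of sixfold products. -/

section

/-- A family of functions of time, the `k`-th one with frequencies within `1` of `ψ k` and with
energy at most `e k`. -/
structure WavePackets (ψ : ℤ → ℝ) (F : ℤ → ℝ → ℂ) (e : ℤ → ℝ) : Prop where
  bandLimited : ∀ k, BandLimited (F k) (ψ k) 1
  memLp : ∀ k, MemLp (F k) 2 volume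
  -- The Bernstein bound: Cauchy–Schwarz on a frequency band of length `2`.
  sq_le : ∀ k t, ‖F k t‖ ^ 2 ≤ 2 * e k
  integral_le : ∀ k, ∫ t, ‖F k t‖ ^ 2 ≤ e k

/-- The function `∑_{k ∈ S} e^{ikx} F_k(t)`. -/
def modeSum (F : ℤ → ℝ → ℂ) (S : Finset ℤ) (z : Torus × ℝ) : ℂ :=
  ∑ k ∈ S, fourier k z.1 * F k z.2

theorem norm_fourier_apply (k : ℤ) (x : Torus) : ‖(fourier k x : ℂ)‖ = 1 := by
  rw [fourier_apply, Circle.norm_coe]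

variable {ψ : ℤ → ℝ} {F : ℤ → ℝ → ℂ} {e : ℤ → ℝ}

theorem WavePackets.energy_nonneg (h : WavePackets ψ F e) (k : ℤ) : 0 ≤ e k :=
  (integral_nonneg fun _ => by positivity).trans (h.integral_le k)

theorem WavePackets.sum_energy_nonneg (h : WavePackets ψ F e) (S : Finset ℤ) :
    0 ≤ ∑ k ∈ S, e k :=
  Finset.sum_nonneg fun k _ => h.energy_nonneg k

theorem WavePackets.continuous (h : WavePackets ψ F e) (k : ℤ) : Continuous (F k) :=
  (h.bandLimited k).continuous

theorem WavePackets.norm_le (h : WavePackets ψ F e) (k : ℤ) (t : ℝ) :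
    ‖F k t‖ ≤ √(2 * e k) :=
  Real.le_sqrt_of_sq_le (h.sq_le k t)

theorem WavePackets.continuous_modeSum (h : WavePackets ψ F e) (S : Finset ℤ) :
    Continuous (modeSum F S) := by
  refine continuous_finsetSum _ fun k _ => ?_
  exact ((fourier k).continuous.comp continuous_fst).mul ((h.continuous k).comp continuous_snd)

theorem WavePackets.norm_modeSum_le (h : WavePackets ψ F e) (S : Finset ℤ) (z : Torus × ℝ) :
    ‖modeSum F S z‖ ≤ ∑ k ∈ S, √(2 * e k) := by
  refine (norm_sum_le _ _).trans (Finset.sum_le_sum fun k _ => ?_)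
  rw [norm_mul, norm_fourier_apply, one_mul]
  exact h.norm_le k z.2

theorem WavePackets.integrable_sq (h : WavePackets ψ F e) (k : ℤ) :
    Integrable (fun t => ‖F k t‖ ^ 2) :=
  (memLp_two_iff_integrable_sq_norm (h.memLp k).1).1 (h.memLp k)

theorem WavePackets.memLp_modeSum (h : WavePackets ψ F e) (S : Finset ℤ) :
    MemLp (modeSum F S) 2 volume := by
  refine memLp_finsetSum _ fun k _ => ?_
  have hc : Continuous fun z : Torus × ℝ => (fourier k z.1 : ℂ) * F k z.2 :=
    ((fourier k).continuous.comp continuous_fst).mul ((h.continuous k).comp continuous_snd)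
  refine (memLp_two_iff_integrable_sq_norm hc.aestronglyMeasurable).2 ?_
  have h1 : Integrable (fun z : Torus × ℝ => ‖F k z.2‖ ^ 2) volume :=
    (h.integrable_sq k).comp_snd (volume : Measure Torus)
  refine h1.congr (Filter.Eventually.of_forall fun z => ?_)
  simp only [norm_mul, norm_fourier_apply, one_mul]

/-- Two of the factors are square integrable and all the others are bounded. -/
theorem WavePackets.integrable_pow_mul_pow (h : WavePackets ψ F e) (S S' : Finset ℤ)
    {a b : ℕ} (ha : 2 ≤ a) :
    Integrable (fun z => ‖modeSum F S z‖ ^ a * ‖modeSum F S' z‖ ^ b) := by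
  have h1 := (memLp_two_iff_integrable_sq_norm (h.memLp_modeSum S).1).1 (h.memLp_modeSum S)
  obtain ⟨c, rfl⟩ := Nat.exists_eq_add_of_le ha
  have hc := (h.continuous_modeSum S).norm
  have hc' := (h.continuous_modeSum S').norm
  refine (h1.mul_bdd (c := (∑ k ∈ S, √(2 * e k)) ^ c * (∑ k ∈ S', √(2 * e k)) ^ b)
    (g := fun z => ‖modeSum F S z‖ ^ c * ‖modeSum F S' z‖ ^ b)
    ((hc.pow c).mul (hc'.pow b)).aestronglyMeasurable
    (Filter.Eventually.of_forall fun z => ?_)).congr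
    (Filter.Eventually.of_forall fun z => ?_)
  · rw [Real.norm_of_nonneg (by positivity)]
    gcongr
    · exact h.norm_modeSum_le S z
    · exact h.norm_modeSum_le S' z
  · simp only
    ring

theorem WavePackets.integrable_pow (h : WavePackets ψ F e) (S : Finset ℤ)
    {a : ℕ} (ha : 2 ≤ a) : Integrable (fun z => ‖modeSum F S z‖ ^ a) := by
  simpa using h.integrable_pow_mul_pow S ∅ (b := 0) ha

theorem sum_mul_sum_product {ι κ : Type*} (s : Finset ι) (t : Finset κ) (f : ι → ℂ) (g : κ → ℂ) :
    (∑ i ∈ s, f i) * ∑ j ∈ t, g j = ∑ p ∈ s ×ˢ t, f p.1 * g p.2 := by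
  rw [Finset.sum_mul_sum, Finset.sum_product]

/-- The sixfold product in time of packets and conjugate packets. -/
def sixProduct (F : ℤ → ℝ → ℂ) (p : (ℤ × ℤ) × ((ℤ × ℤ) × (ℤ × ℤ))) (t : ℝ) : ℂ :=
  (F p.1.1 t * starRingEnd ℂ (F p.1.2 t)) * ((F p.2.1.1 t * F p.2.1.2 t) *
    (starRingEnd ℂ (F p.2.2.1 t) * starRingEnd ℂ (F p.2.2.2 t)))

theorem WavePackets.integrable_sixProduct (h : WavePackets ψ F e)
    (p : (ℤ × ℤ) × ((ℤ × ℤ) × (ℤ × ℤ))) : Integrable (sixProduct F p) := by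
  have h1 : Integrable (fun t => F p.1.1 t * starRingEnd ℂ (F p.1.2 t)) :=
    (h.memLp _).integrable_mul (h.memLp _).star
  have hc : Continuous fun t => (F p.2.1.1 t * F p.2.1.2 t) *
      (starRingEnd ℂ (F p.2.2.1 t) * starRingEnd ℂ (F p.2.2.2 t)) :=
    ((h.continuous _).mul (h.continuous _)).mul
      ((Complex.continuous_conj.comp (h.continuous _)).mul
        (Complex.continuous_conj.comp (h.continuous _)))
  refine h1.mul_bdd (c := (√(2 * e p.2.1.1) * √(2 * e p.2.1.2)) *
    (√(2 * e p.2.2.1) * √(2 * e p.2.2.2))) hc.aestronglyMeasurable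
    (Filter.Eventually.of_forall fun t => ?_)
  simp only [norm_mul, RCLike.norm_conj]
  gcongr <;> exact h.norm_le _ _

theorem WavePackets.bandLimited_sixProduct (h : WavePackets ψ F e)
    (p : (ℤ × ℤ) × ((ℤ × ℤ) × (ℤ × ℤ))) :
    BandLimited (sixProduct F p) ((ψ p.1.1 + -ψ p.1.2) + ((ψ p.2.1.1 + ψ p.2.1.2) +
      (-ψ p.2.2.1 + -ψ p.2.2.2))) ((1 + 1) + ((1 + 1) + (1 + 1))) :=
  ((h.bandLimited _).mul (h.bandLimited _).conj).mul
    (((h.bandLimited _).mul (h.bandLimited _)).mul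
      ((h.bandLimited _).conj.mul (h.bandLimited _).conj))

theorem modeSum_product_expand (F : ℤ → ℝ → ℂ) (J J' I : Finset ℤ) (z : Torus × ℝ) :
    modeSum F J z * starRingEnd ℂ (modeSum F J' z) * (‖modeSum F I z‖ ^ 4 : ℝ) =
      ∑ p ∈ (J ×ˢ J') ×ˢ ((I ×ˢ I) ×ˢ (I ×ˢ I)),
        fourier ((p.1.1 + -p.1.2) + ((p.2.1.1 + p.2.1.2) + (-p.2.2.1 + -p.2.2.2))) z.1 *
          sixProduct F p z.2 := by
  have h4 : ((‖modeSum F I z‖ ^ 4 : ℝ) : ℂ) = (modeSum F I z * modeSum F I z) *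
      (starRingEnd ℂ (modeSum F I z) * starRingEnd ℂ (modeSum F I z)) := by
    have := Complex.mul_conj' (modeSum F I z)
    push_cast
    linear_combination (-(‖modeSum F I z‖ : ℂ) ^ 2 -
      modeSum F I z * starRingEnd ℂ (modeSum F I z)) * this
  rw [h4]
  simp only [modeSum, map_sum, sum_mul_sum_product]
  refine Finset.sum_congr rfl fun p _ => ?_
  simp only [sixProduct, fourier_add, fourier_neg, map_mul]
  ring

/-- Every term of the expansion dies: if its space frequency is nonzero, the torus integral
vanishes; otherwise its time frequencies stay away from `0`, since six bands of radius `1` multiply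
to a band of radius `6`. -/
theorem WavePackets.integral_product_eq_zero (h : WavePackets ψ F e) {J J' I : Finset ℤ}
    (hJ : ∀ k ∈ J, ∀ k' ∈ J', ∀ l₁ ∈ I, ∀ l₂ ∈ I, ∀ l₃ ∈ I, ∀ l₄ ∈ I,
      k - k' + (l₁ + l₂ - l₃ - l₄) = 0 →
        6 < |ψ k - ψ k' + (ψ l₁ + ψ l₂ - ψ l₃ - ψ l₄)|) :
    ∫ z, modeSum F J z * starRingEnd ℂ (modeSum F J' z) * (‖modeSum F I z‖ ^ 4 : ℝ) = 0 := by
  simp only [modeSum_product_expand]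
  rw [integral_finsetSum]
  · refine Finset.sum_eq_zero fun p hp => ?_
    simp only [Finset.mem_product] at hp
    obtain ⟨⟨hk, hk'⟩, ⟨hl₁, hl₂⟩, hl₃, hl₄⟩ := hp
    rw [Measure.volume_eq_prod, integral_prod_mul (fun x : Torus => (fourier _ x : ℂ))]
    by_cases hn : (p.1.1 + -p.1.2) + ((p.2.1.1 + p.2.1.2) + (-p.2.2.1 + -p.2.2.2)) = 0
    · rw [(h.bandLimited_sixProduct p).integral_eq_zero (h.integrable_sixProduct p), mul_zero]
      have := hJ _ hk _ hk' _ hl₁ _ hl₂ _ hl₃ _ hl₄ (by rw [← hn]; ring)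
      norm_num
      convert this using 2
      ring
    · rw [integral_torus_fourier hn, zero_mul]
  · intro p _
    rw [Measure.volume_eq_prod]
    exact Integrable.mul_prod (f := fun x : Torus => (fourier _ x : ℂ))
      ((fourier _).continuous.integrable_of_hasCompactSupport (HasCompactSupport.of_compactSpace _))
      (h.integrable_sixProduct p)

end

/-! ### Bilinear integrals, orthogonality and curvature. -/

section

theorem sq_integral_mul_le {α : Type*} [MeasurableSpace α] {μ : Measure α} {a b : α → ℝ}
    (ha : 0 ≤ a) (hb : 0 ≤ b) (ha2 : MemLp a 2 μ) (hb2 : MemLp b 2 μ) :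
    (∫ z, a z * b z ∂μ) ^ 2 ≤ (∫ z, a z ^ 2 ∂μ) * ∫ z, b z ^ 2 ∂μ := by
  have h1 := integral_mul_le_Lp_mul_Lq_of_nonneg (μ := μ) (Real.HolderConjugate.two_two)
    (Filter.Eventually.of_forall ha) (Filter.Eventually.of_forall hb)
    (by simpa using ha2) (by simpa using hb2)
  simp only [Real.rpow_two, ← Real.sqrt_eq_rpow] at h1
  have h0 : 0 ≤ ∫ z, a z * b z ∂μ := integral_nonneg fun z => mul_nonneg (ha z) (hb z)
  calc (∫ z, a z * b z ∂μ) ^ 2 ≤ (√(∫ z, a z ^ 2 ∂μ) * √(∫ z, b z ^ 2 ∂μ)) ^ 2 := by gcongr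
    _ = _ := by
      rw [mul_pow, Real.sq_sqrt (integral_nonneg fun z => sq_nonneg _),
        Real.sq_sqrt (integral_nonneg fun z => sq_nonneg _)]

/-- `∫ |F_S|^a |F_I|^b`. -/
def mixedIntegral (F : ℤ → ℝ → ℂ) (a b : ℕ) (S I : Finset ℤ) : ℝ :=
  ∫ z, ‖modeSum F S z‖ ^ a * ‖modeSum F I z‖ ^ b

theorem mixedIntegral_nonneg (F : ℤ → ℝ → ℂ) (a b : ℕ) (S I : Finset ℤ) :
    0 ≤ mixedIntegral F a b S I :=
  integral_nonneg fun _ => by positivity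

variable {ψ : ℤ → ℝ} {F : ℤ → ℝ → ℂ} {e : ℤ → ℝ}

theorem WavePackets.memLp_pow_mul_pow (h : WavePackets ψ F e) (S I : Finset ℤ)
    {a b : ℕ} (ha : 1 ≤ a) :
    MemLp (fun z => ‖modeSum F S z‖ ^ a * ‖modeSum F I z‖ ^ b) 2 volume := by
  have hc : Continuous fun z => ‖modeSum F S z‖ ^ a * ‖modeSum F I z‖ ^ b :=
    ((h.continuous_modeSum S).norm.pow a).mul ((h.continuous_modeSum I).norm.pow b)
  refine (memLp_two_iff_integrable_sq hc.aestronglyMeasurable).2 ?_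
  have := h.integrable_pow_mul_pow S I (a := 2 * a) (b := 2 * b) (by omega)
  refine this.congr (Filter.Eventually.of_forall fun z => ?_)
  simp only
  ring

/-- Cauchy–Schwarz for `|F_S|²|F_I|⁴ = (|F_S|²|F_I|) |F_I|³`. It exchanges the roles of `S` and `I`,
so that a refined `S` can next serve as the quartic weight. -/
theorem WavePackets.mixedIntegral_sq_le (h : WavePackets ψ F e) (S I : Finset ℤ) :
    mixedIntegral F 2 4 S I ^ 2 ≤
      mixedIntegral F 2 4 I S * ∫ z, ‖modeSum F I z‖ ^ 6 := by
  have hb := h.memLp_pow_mul_pow I ∅ (a := 3) (b := 0) (by norm_num)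
  simp only [pow_zero, mul_one] at hb
  have key := sq_integral_mul_le (μ := (volume : Measure (Torus × ℝ)))
    (a := fun z => ‖modeSum F S z‖ ^ 2 * ‖modeSum F I z‖ ^ 1)
    (b := fun z => ‖modeSum F I z‖ ^ 3)
    (fun z => by positivity) (fun z => by positivity)
    (h.memLp_pow_mul_pow S I (by norm_num)) hb
  refine (le_of_eq ?_).trans (key.trans (le_of_eq ?_))
  · rw [mixedIntegral]
    congr 2
    funext z
    ring
  · rw [mixedIntegral]
    congr 2
    · funext z
      ring
    · funext z
      ring

theorem modeSum_fiberwise (F : ℤ → ℝ → ℂ) (S : Finset ℤ) (f : ℤ → ℤ) (z : Torus × ℝ) :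
    modeSum F S z = ∑ q ∈ S.image f, modeSum F (S.filter fun k => f k = q) z := by
  simp only [modeSum]
  exact (Finset.sum_fiberwise_of_maps_to (fun _ hk => Finset.mem_image_of_mem f hk) _).symm

theorem sum_fiberwise_image (e : ℤ → ℝ) (S : Finset ℤ) (f : ℤ → ℤ) :
    ∑ q ∈ S.image f, ∑ k ∈ S.filter (fun k => f k = q), e k = ∑ k ∈ S, e k :=
  Finset.sum_fiberwise_of_maps_to (fun _ hk => Finset.mem_image_of_mem f hk) _

theorem card_filter_abs_sub_le_one (Q : Finset ℤ) (q : ℤ) :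
    (Q.filter fun q' => |q - q'| ≤ 1).card ≤ 3 := by
  have : Q.filter (fun q' => |q - q'| ≤ 1) ⊆ Finset.Icc (q - 1) (q + 1) := by
    intro x hx
    have := abs_le.1 (Finset.mem_filter.1 hx).2
    rw [Finset.mem_Icc]
    constructor <;> linarith [this.1, this.2]
  refine (Finset.card_le_card this).trans ?_
  rw [Int.card_Icc]
  omega

/-- If the pieces of `S` interact with `|F_I|⁴` only when they are adjacent, then `|F_S|²` may be
replaced by the square function. -/
theorem WavePackets.mixedIntegral_le_of_orthogonal (h : WavePackets ψ F e) (S I : Finset ℤ)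
    (f : ℤ → ℤ)
    (hf : ∀ k ∈ S, ∀ k' ∈ S, 1 < |f k - f k'| →
      ∀ l₁ ∈ I, ∀ l₂ ∈ I, ∀ l₃ ∈ I, ∀ l₄ ∈ I, k - k' + (l₁ + l₂ - l₃ - l₄) = 0 →
        6 < |ψ k - ψ k' + (ψ l₁ + ψ l₂ - ψ l₃ - ψ l₄)|) :
    mixedIntegral F 2 4 S I ≤
      3 * ∑ q ∈ S.image f, mixedIntegral F 2 4 (S.filter fun k => f k = q) I := by
  set Q := S.image f
  let J : ℤ → Finset ℤ := fun q => S.filter fun k => f k = q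
  let Y : ℤ → ℝ := fun q => mixedIntegral F 2 4 (J q) I
  have hY : ∀ q, 0 ≤ Y q := fun q => mixedIntegral_nonneg _ _ _ _ _
  let T : ℤ → ℤ → Torus × ℝ → ℂ := fun q q' z =>
    modeSum F (J q) z * starRingEnd ℂ (modeSum F (J q') z) * (‖modeSum F I z‖ ^ 4 : ℝ)
  have hTn : ∀ q q' z, ‖T q q' z‖ ≤
      (1 / 2) * (‖modeSum F (J q) z‖ ^ 2 * ‖modeSum F I z‖ ^ 4 +
        ‖modeSum F (J q') z‖ ^ 2 * ‖modeSum F I z‖ ^ 4) := by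
    intro q q' z
    simp only [T, norm_mul, RCLike.norm_conj]
    rw [Complex.norm_real, Real.norm_of_nonneg (by positivity : 0 ≤ ‖modeSum F I z‖ ^ 4)]
    have := mul_nonneg (sq_nonneg (‖modeSum F (J q) z‖ - ‖modeSum F (J q') z‖))
      (by positivity : 0 ≤ ‖modeSum F I z‖ ^ 4)
    linarith
  have hDint : ∀ q q', Integrable fun z =>
      (1 / 2) * (‖modeSum F (J q) z‖ ^ 2 * ‖modeSum F I z‖ ^ 4 +
        ‖modeSum F (J q') z‖ ^ 2 * ‖modeSum F I z‖ ^ 4) := fun q q' =>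
    ((h.integrable_pow_mul_pow _ _ le_rfl).add
      (h.integrable_pow_mul_pow _ _ le_rfl)).const_mul _
  have hTint : ∀ q q', Integrable (T q q') := fun q q' => by
    refine (hDint q q').mono' ?_ (Filter.Eventually.of_forall (hTn q q'))
    refine Continuous.aestronglyMeasurable ?_
    exact ((h.continuous_modeSum _).mul
      (Complex.continuous_conj.comp (h.continuous_modeSum _))).mul
      (Complex.continuous_ofReal.comp ((h.continuous_modeSum I).norm.pow 4))
  have hTle : ∀ q q', ‖∫ z, T q q' z‖ ≤ (1 / 2) * (Y q + Y q') := fun q q' => by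
    refine (norm_integral_le_of_norm_le (hDint q q')
      (Filter.Eventually.of_forall (hTn q q'))).trans (le_of_eq ?_)
    rw [integral_const_mul, integral_add (h.integrable_pow_mul_pow _ _ le_rfl)
      (h.integrable_pow_mul_pow _ _ le_rfl)]
    rfl
  have hTz : ∀ q q', ¬ |q - q'| ≤ 1 → ∫ z, T q q' z = 0 := fun q q' hqq => by
    refine h.integral_product_eq_zero ?_
    intro k hk k' hk'
    obtain ⟨hkS, rfl⟩ := Finset.mem_filter.1 hk
    obtain ⟨hkS', rfl⟩ := Finset.mem_filter.1 hk'
    exact hf k hkS k' hkS' (not_le.1 hqq)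
  have hexp : ((mixedIntegral F 2 4 S I : ℝ) : ℂ) = ∑ q ∈ Q, ∑ q' ∈ Q, ∫ z, T q q' z := by
    rw [mixedIntegral, ← integral_complex_ofReal]
    simp_rw [← integral_finsetSum Q fun q' _ => hTint _ q']
    rw [← integral_finsetSum Q fun q _ => integrable_finsetSum Q fun q' _ => hTint q q']
    congr 1
    funext z
    have h2 := (Complex.mul_conj' (modeSum F S z)).symm
    push_cast
    rw [h2, modeSum_fiberwise F S f z, map_sum, Finset.sum_mul_sum, Finset.sum_mul]
    refine Finset.sum_congr rfl fun q _ => ?_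
    rw [Finset.sum_mul]
    refine Finset.sum_congr rfl fun q' _ => ?_
    simp [T, J]
  have hcount : ∀ q, ∑ q' ∈ Q, (if |q - q'| ≤ 1 then Y q else 0) ≤ 3 * Y q := fun q => by
    rw [← Finset.sum_filter, Finset.sum_const, nsmul_eq_mul]
    have : ((Q.filter fun q' => |q - q'| ≤ 1).card : ℝ) ≤ 3 := by
      exact_mod_cast card_filter_abs_sub_le_one Q q
    exact mul_le_mul_of_nonneg_right this (hY q)
  have h0 := mixedIntegral_nonneg F 2 4 S I
  calc mixedIntegral F 2 4 S I = ‖((mixedIntegral F 2 4 S I : ℝ) : ℂ)‖ := by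
        rw [Complex.norm_real, Real.norm_of_nonneg h0]
    _ ≤ ∑ q ∈ Q, ∑ q' ∈ Q, ‖∫ z, T q q' z‖ := by
        rw [hexp]
        exact (norm_sum_le _ _).trans (Finset.sum_le_sum fun q _ => norm_sum_le _ _)
    -- Only near-diagonal pairs survive; by AM–GM each is charged half to either piece, and a piece
    -- has at most three neighbours, itself included.
    _ ≤ ∑ q ∈ Q, ∑ q' ∈ Q, ((1 / 2) * (if |q - q'| ≤ 1 then Y q else 0) +
          (1 / 2) * (if |q' - q| ≤ 1 then Y q' else 0)) := by
        refine Finset.sum_le_sum fun q _ => Finset.sum_le_sum fun q' _ => ?_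
        rw [abs_sub_comm q' q]
        split_ifs with hq
        · linarith [hTle q q']
        · simp [hTz q q' hq]
    _ = (1 / 2) * ∑ q ∈ Q, ∑ q' ∈ Q, (if |q - q'| ≤ 1 then Y q else 0) +
          (1 / 2) * ∑ q' ∈ Q, ∑ q ∈ Q, (if |q' - q| ≤ 1 then Y q' else 0) := by
        simp only [Finset.sum_add_distrib, ← Finset.mul_sum]
        congr 2
        exact Finset.sum_comm
    _ = ∑ q ∈ Q, ∑ q' ∈ Q, (if |q - q'| ≤ 1 then Y q else 0) := by ring
    _ ≤ ∑ q ∈ Q, 3 * Y q := Finset.sum_le_sum fun q _ => hcount q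
    _ = 3 * ∑ q ∈ Q, Y q := by rw [Finset.mul_sum]

/-- A phase on the convex set `U` whose second derivative has constant sign and is comparable
to `Λ ≥ 1`, expressed through the increments of the derivative `p`. -/
structure CurvedPhase (B Λ : ℝ) (U : Set ℝ) (φ p : ℝ → ℝ) : Prop where
  one_le_ratio : 1 ≤ B
  one_le_curvature : 1 ≤ Λ
  ordConnected : U.OrdConnected
  hasDerivAt : ∀ x ∈ U, HasDerivAt φ (p x) x
  le_abs_sub : ∀ x ∈ U, ∀ y ∈ U, Λ * |x - y| ≤ |p x - p y|
  abs_sub_le : ∀ x ∈ U, ∀ y ∈ U, |p x - p y| ≤ B * Λ * |x - y|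

variable {B Λ : ℝ} {U : Set ℝ} {φ p : ℝ → ℝ}

theorem CurvedPhase.exists_slope (H : CurvedPhase B Λ U φ p) {x y : ℝ} (hx : x ∈ U)
    (hy : y ∈ U) : ∃ ξ ∈ U, (ξ ∈ Set.uIcc x y) ∧ φ x - φ y = p ξ * (x - y) := by
  have main : ∀ {x y : ℝ}, x ∈ U → y ∈ U → x < y →
      ∃ ξ ∈ U, (ξ ∈ Set.uIcc x y) ∧ φ x - φ y = p ξ * (x - y) := by
    intro x y hx hy hxy
    have hsub : Set.Icc x y ⊆ U := H.ordConnected.out hx hy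
    obtain ⟨ξ, hξ, he⟩ := exists_hasDerivAt_eq_slope φ p hxy
      (fun z hz => (H.hasDerivAt z (hsub hz)).continuousAt.continuousWithinAt)
      (fun z hz => H.hasDerivAt z (hsub (Set.Ioo_subset_Icc_self hz)))
    refine ⟨ξ, hsub (Set.Ioo_subset_Icc_self hξ), ?_, ?_⟩
    · rw [Set.uIcc_of_le hxy.le]
      exact Set.Ioo_subset_Icc_self hξ
    · rw [he]
      have : y - x ≠ 0 := by linarith
      field_simp
      ring
  rcases lt_trichotomy x y with hxy | rfl | hxy
  · exact main hx hy hxy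
  · exact ⟨x, hx, by simp, by simp⟩
  · obtain ⟨ξ, h1, h2, h3⟩ := main hy hx hxy
    refine ⟨ξ, h1, by rwa [Set.uIcc_comm], by linarith⟩

theorem CurvedPhase.abs_taylor_le (H : CurvedPhase B Λ U φ p) {x y A : ℝ} (hx : x ∈ U)
    (hy : y ∈ U) (hxy : |x - y| ≤ A) :
    |φ x - φ y - p y * (x - y)| ≤ B * Λ * A ^ 2 := by
  obtain ⟨ξ, hξ, hm, he⟩ := H.exists_slope hx hy
  have h1 := H.abs_sub_le ξ hξ y hy
  have h2 : |ξ - y| ≤ |x - y| := by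
    rcases Set.mem_uIcc.1 hm with hm | hm
    · rw [abs_of_nonpos (by linarith [hm.2]), abs_of_nonpos (by linarith [hm.1, hm.2])]
      linarith [hm.1]
    · rw [abs_of_nonneg (by linarith [hm.1]), abs_of_nonneg (by linarith [hm.1, hm.2])]
      linarith [hm.2]
  rw [he, ← sub_mul, abs_mul]
  have hB := H.one_le_ratio
  have hL := H.one_le_curvature
  calc |p ξ - p y| * |x - y| ≤ (B * Λ * |ξ - y|) * |x - y| := by gcongr
    _ ≤ (B * Λ * A) * A := by
      have := h2.trans hxy
      have := (abs_nonneg _).trans this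
      gcongr
    _ = _ := by ring

/-- The mean-value point lies between `x` and `y`, hence at distance at least `d` from `z`, and the
slope there differs from `p z` by at least `Λ * d`. -/
theorem CurvedPhase.le_abs_taylor (H : CurvedPhase B Λ U φ p) {x y z d : ℝ} (hx : x ∈ U)
    (hy : y ∈ U) (hz : z ∈ U)
    (hd : (x + d ≤ z ∧ y + d ≤ z) ∨ (z + d ≤ x ∧ z + d ≤ y)) :
    Λ * d * |x - y| ≤ |φ x - φ y - p z * (x - y)| := by
  obtain ⟨ξ, hξ, hm, he⟩ := H.exists_slope hx hy
  have h1 := H.le_abs_sub ξ hξ z hz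
  have h2 : d ≤ |ξ - z| := by
    rw [Set.mem_uIcc] at hm
    rw [le_abs]
    rcases hd with ⟨h, h'⟩ | ⟨h, h'⟩
    · right
      rcases hm with hm | hm <;> linarith [hm.1, hm.2]
    · left
      rcases hm with hm | hm <;> linarith [hm.1, hm.2]
  rw [he, ← sub_mul, abs_mul]
  have hL := H.one_le_curvature
  calc Λ * d * |x - y| ≤ Λ * |ξ - z| * |x - y| := by gcongr
    _ ≤ _ := by gcongr

/-- `S` and `I` lie on two sides of a gap of length `d`. -/
def Separated (d : ℝ) (S I : Finset ℤ) : Prop :=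
  (∀ k ∈ S, ∀ l ∈ I, (k : ℝ) + d ≤ l) ∨ (∀ k ∈ S, ∀ l ∈ I, (l : ℝ) + d ≤ k)

theorem Separated.symm {d : ℝ} {S I : Finset ℤ} (h : Separated d S I) : Separated d I S :=
  h.elim (fun h => Or.inr fun l hl k hk => h k hk l hl)
    fun h => Or.inl fun l hl k hk => h k hk l hl

theorem Separated.mono {d : ℝ} {S I S' I' : Finset ℤ} (h : Separated d S I) (hS : S' ⊆ S)
    (hI : I' ⊆ I) : Separated d S' I' :=
  h.imp (fun h k hk l hl => h k (hS hk) l (hI hl)) fun h k hk l hl => h k (hS hk) l (hI hl)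

/-- The diameter of `S` is at most `R`. -/
def DiamLE (S : Finset ℤ) (R : ℝ) : Prop := ∀ k ∈ S, ∀ l ∈ S, |(k : ℝ) - l| ≤ R

theorem DiamLE.mono {S T : Finset ℤ} {R R' : ℝ} (h : DiamLE S R) (hT : T ⊆ S) (hR : R ≤ R') :
    DiamLE T R' := fun k hk l hl => (h k (hT hk) l (hT hl)).trans hR

theorem diamLE_fiber (S : Finset ℤ) {R : ℝ} (hR : 0 < R) (q : ℤ) :
    DiamLE (S.filter fun k => ⌊(k : ℝ) / R⌋ = q) R := by
  intro k hk l hl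
  have h1 := (Finset.mem_filter.1 hk).2
  have h2 := (Finset.mem_filter.1 hl).2
  have := Int.abs_sub_lt_one_of_floor_eq_floor (h1.trans h2.symm)
  rw [← sub_div, abs_div, abs_of_pos hR, div_lt_one hR] at this
  exact this.le

theorem lt_abs_sub_of_floor_div {R : ℝ} (hR : 0 < R) {k l : ℤ}
    (h : 1 < |⌊(k : ℝ) / R⌋ - ⌊(l : ℝ) / R⌋|) : R < |(k : ℝ) - l| := by
  by_contra hle
  have h1 : |(k : ℝ) / R - l / R| ≤ 1 := by
    rw [← sub_div, abs_div, abs_of_pos hR, div_le_one hR]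
    exact not_lt.1 hle
  have h2 := abs_le.1 h1
  have a1 := Int.floor_le ((k : ℝ) / R)
  have a2 := Int.lt_floor_add_one ((k : ℝ) / R)
  have b1 := Int.floor_le ((l : ℝ) / R)
  have b2 := Int.lt_floor_add_one ((l : ℝ) / R)
  have h3 : (⌊(k : ℝ) / R⌋ : ℝ) < ⌊(l : ℝ) / R⌋ + 2 := by linarith [h2.2]
  have h4 : (⌊(l : ℝ) / R⌋ : ℝ) < ⌊(k : ℝ) / R⌋ + 2 := by linarith [h2.1]
  have h3' : ⌊(k : ℝ) / R⌋ < ⌊(l : ℝ) / R⌋ + 2 := by exact_mod_cast h3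
  have h4' : ⌊(l : ℝ) / R⌋ < ⌊(k : ℝ) / R⌋ + 2 := by exact_mod_cast h4
  rcases lt_abs.1 h with h | h <;> omega

/-- Subtracting `p l₁` times the linear relation removes all first-order terms. Separation makes the
remainder of the pair `k, k'` at least `Λ * d * |k - k'|`, which exceeds `(4 * B + 6) * Λ * A ^ 2`.
The three remainders inside `I` take away at most `3 * B * Λ * A ^ 2`, and more than `6` is left
because `Λ` and `A` are at least `1`. -/
theorem CurvedPhase.frequency_gap (H : CurvedPhase B Λ U φ p) {d A : ℝ} (hd : 0 < d)
    (hA : 1 ≤ A) {S I : Finset ℤ} (hS : ∀ k ∈ S, (k : ℝ) ∈ U) (hI : ∀ k ∈ I, (k : ℝ) ∈ U)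
    (hsep : Separated d S I) (hIA : DiamLE I A) {k k' l₁ l₂ l₃ l₄ : ℤ} (hk : k ∈ S)
    (hk' : k' ∈ S) (hl₁ : l₁ ∈ I) (hl₂ : l₂ ∈ I) (hl₃ : l₃ ∈ I) (hl₄ : l₄ ∈ I)
    (hkk : (4 * B + 6) * A ^ 2 / d < |(k : ℝ) - k'|)
    (hsum : k - k' + (l₁ + l₂ - l₃ - l₄) = 0) :
    6 < |φ k - φ k' + (φ l₁ + φ l₂ - φ l₃ - φ l₄)| := by
  have h1 : Λ * d * |(k : ℝ) - k'| ≤ |φ k - φ k' - p l₁ * (k - k')| := by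
    refine H.le_abs_taylor (hS k hk) (hS k' hk') (hI l₁ hl₁) ?_
    exact hsep.imp (fun h => ⟨h k hk l₁ hl₁, h k' hk' l₁ hl₁⟩)
      fun h => ⟨h k hk l₁ hl₁, h k' hk' l₁ hl₁⟩
  have h2 := H.abs_taylor_le (hI l₂ hl₂) (hI l₁ hl₁) (hIA l₂ hl₂ l₁ hl₁)
  have h3 := H.abs_taylor_le (hI l₃ hl₃) (hI l₁ hl₁) (hIA l₃ hl₃ l₁ hl₁)
  have h4 := H.abs_taylor_le (hI l₄ hl₄) (hI l₁ hl₁) (hIA l₄ hl₄ l₁ hl₁)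
  have hL := H.one_le_curvature
  have hB := H.one_le_ratio
  have hsum' : (k : ℝ) - k' + (l₁ + l₂ - l₃ - l₄) = 0 := by exact_mod_cast hsum
  have h5 : (4 * B + 6) * A ^ 2 < |(k : ℝ) - k'| * d := (div_lt_iff₀ hd).1 hkk
  have h6 : Λ * ((4 * B + 6) * A ^ 2) < Λ * (|(k : ℝ) - k'| * d) :=
    mul_lt_mul_of_pos_left h5 (by linarith)
  have h7 : 1 ≤ Λ * A ^ 2 := one_le_mul_of_one_le_of_one_le hL (one_le_pow₀ hA)
  have h8 : 1 ≤ B * (Λ * A ^ 2) := one_le_mul_of_one_le_of_one_le hB h7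
  have hid : φ k - φ k' + (φ l₁ + φ l₂ - φ l₃ - φ l₄) =
      (φ k - φ k' - p l₁ * (k - k')) + ((φ l₂ - φ l₁ - p l₁ * (l₂ - l₁)) -
        (φ l₃ - φ l₁ - p l₁ * (l₃ - l₁)) - (φ l₄ - φ l₁ - p l₁ * (l₄ - l₁))) := by
    linear_combination (p l₁) * hsum'
  rw [hid]
  set X := φ k - φ k' - p l₁ * (k - k')
  set X₂ := φ l₂ - φ l₁ - p l₁ * (l₂ - l₁)
  set X₃ := φ l₃ - φ l₁ - p l₁ * (l₃ - l₁)
  set X₄ := φ l₄ - φ l₁ - p l₁ * (l₄ - l₁)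
  have h9 : |X| ≤ |X + (X₂ - X₃ - X₄)| + (|X₂| + |X₃| + |X₄|) := by
    have e1 := abs_sub (X + (X₂ - X₃ - X₄)) (X₂ - X₃ - X₄)
    have e2 := abs_sub (X₂ - X₃) X₄
    have e3 := abs_sub X₂ X₃
    have e4 : X + (X₂ - X₃ - X₄) - (X₂ - X₃ - X₄) = X := by ring
    rw [e4] at e1
    linarith
  have h10 : Λ * ((4 * B + 6) * A ^ 2) = 4 * (B * Λ * A ^ 2) + 6 * (Λ * A ^ 2) := by ring
  linarith

theorem CurvedPhase.mixedIntegral_le (H : CurvedPhase B Λ U φ p)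
    (h : WavePackets (fun k => φ k) F e) {d A R : ℝ} (hd : 0 < d)
    (hA : 1 ≤ A) (hR : R = (4 * B + 6) * A ^ 2 / d) {S I : Finset ℤ}
    (hS : ∀ k ∈ S, (k : ℝ) ∈ U) (hI : ∀ k ∈ I, (k : ℝ) ∈ U)
    (hsep : Separated d S I) (hIA : DiamLE I A) :
    mixedIntegral F 2 4 S I ≤ 3 * ∑ q ∈ S.image (fun k : ℤ => ⌊(k : ℝ) / R⌋),
      mixedIntegral F 2 4 (S.filter fun k : ℤ => ⌊(k : ℝ) / R⌋ = q) I := by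
  have hB := H.one_le_ratio
  have hR0 : 0 < R := by rw [hR]; positivity
  refine h.mixedIntegral_le_of_orthogonal S I _ ?_
  intro k hk k' hk' hf l₁ hl₁ l₂ hl₂ l₃ hl₃ l₄ hl₄ hsum
  refine H.frequency_gap hd hA hS hI hsep hIA hk hk' hl₁ hl₂ hl₃ hl₄ ?_ hsum
  rw [← hR]
  exact lt_abs_sub_of_floor_div hR0 hf

end

/-! ### The bilinear iteration and the broad–narrow decomposition. -/

section

theorem sum_pow_succ_le_pow_sum {ι : Type*} (s : Finset ι) (f : ι → ℝ) (hf : ∀ i ∈ s, 0 ≤ f i)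
    (n : ℕ) : ∑ i ∈ s, f i ^ (n + 1) ≤ (∑ i ∈ s, f i) ^ (n + 1) := by
  rw [pow_succ, Finset.mul_sum]
  refine Finset.sum_le_sum fun i hi => ?_
  rw [pow_succ]
  exact mul_le_mul_of_nonneg_right
    (pow_le_pow_left₀ (hf i hi) (Finset.single_le_sum hf hi) n) (hf i hi)

theorem norm_sum_pow_succ_le {ι : Type*} (s : Finset ι) (g : ι → ℂ) (n : ℕ) :
    ‖∑ i ∈ s, g i‖ ^ (n + 1) ≤ (s.card : ℝ) ^ n * ∑ i ∈ s, ‖g i‖ ^ (n + 1) := by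
  rcases s.eq_empty_or_nonempty with rfl | hs
  · simp
  have h1 := pow_sum_div_card_le_sum_pow (s := s) (f := fun i => ‖g i‖) (fun _ _ => norm_nonneg _) n
  rw [div_le_iff₀ (by have := hs.card_pos; positivity), mul_comm] at h1
  exact (pow_le_pow_left₀ (norm_nonneg _) (norm_sum_le _ _) _).trans h1

/-- Either one term and its neighbours dominate a sum, or two terms that are not adjacent are
comparable to it. -/
theorem norm_sum_pow_six_le (Q : Finset ℤ) (g : ℤ → ℂ) {N : ℝ} (hN : (Q.card : ℝ) ≤ N) :
    ‖∑ q ∈ Q, g q‖ ^ 6 ≤ 4 ^ 6 * ∑ q ∈ Q, ‖g q‖ ^ 6 +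
      N ^ 10 * ∑ q ∈ Q, ∑ q' ∈ Q.filter (fun q' => 1 < |q - q'|), ‖g q‖ ^ 2 * ‖g q'‖ ^ 4 := by
  rcases Q.eq_empty_or_nonempty with rfl | hQ
  · simp
  have hN1 : 1 ≤ N := le_trans (by exact_mod_cast hQ.card_pos) hN
  obtain ⟨m, hm, hmax⟩ := Q.exists_max_image (fun q => ‖g q‖) hQ
  have hA : 0 ≤ ∑ q ∈ Q, ‖g q‖ ^ 6 := Finset.sum_nonneg fun _ _ => by positivity
  have hB : 0 ≤ ∑ q ∈ Q, ∑ q' ∈ Q.filter (fun q' => 1 < |q - q'|), ‖g q‖ ^ 2 * ‖g q'‖ ^ 4 :=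
    Finset.sum_nonneg fun _ _ => Finset.sum_nonneg fun _ _ => by positivity
  -- With `m` the index of the largest term, either a non-adjacent term is within a factor `N` of
  -- it, which costs `N ^ 6 * N ^ 4`, or all non-adjacent terms together amount to at most `‖g m‖`.
  -- In the second case the at most three adjacent terms bring the total to `4 * ‖g m‖`.
  by_cases hex : ∃ q ∈ Q, 1 < |m - q| ∧ ‖g m‖ ≤ N * ‖g q‖
  · obtain ⟨q, hq, hfar, hle⟩ := hex
    have h1 : ‖∑ q ∈ Q, g q‖ ≤ N * ‖g m‖ := by
      refine (norm_sum_le_of_le Q hmax).trans ?_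
      rw [Finset.sum_const, nsmul_eq_mul]
      gcongr
    have h2 : ‖g m‖ ^ 2 * ‖g q‖ ^ 4 ≤
        ∑ q ∈ Q, ∑ q' ∈ Q.filter (fun q' => 1 < |q - q'|), ‖g q‖ ^ 2 * ‖g q'‖ ^ 4 := by
      refine le_trans ?_ (Finset.single_le_sum (f := fun q =>
        ∑ q' ∈ Q.filter (fun q' => 1 < |q - q'|), ‖g q‖ ^ 2 * ‖g q'‖ ^ 4)
        (fun _ _ => Finset.sum_nonneg fun _ _ => by positivity) hm)
      exact Finset.single_le_sum (f := fun q' => ‖g m‖ ^ 2 * ‖g q'‖ ^ 4)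
        (fun _ _ => by positivity) (Finset.mem_filter.2 ⟨hq, hfar⟩)
    calc ‖∑ q ∈ Q, g q‖ ^ 6 ≤ (N * ‖g m‖) ^ 6 := by gcongr
      _ = N ^ 6 * ‖g m‖ ^ 2 * ‖g m‖ ^ 4 := by ring
      _ ≤ N ^ 6 * ‖g m‖ ^ 2 * (N * ‖g q‖) ^ 4 := by gcongr
      _ = N ^ 10 * (‖g m‖ ^ 2 * ‖g q‖ ^ 4) := by ring
      _ ≤ N ^ 10 * _ := by gcongr
      _ ≤ _ := le_add_of_nonneg_left (by positivity)
  · push Not at hex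
    have h1 : ‖∑ q ∈ Q.filter (fun q => |m - q| ≤ 1), g q‖ ≤ 3 * ‖g m‖ := by
      refine (norm_sum_le_of_le _ fun q hq => hmax q (Finset.mem_filter.1 hq).1).trans ?_
      rw [Finset.sum_const, nsmul_eq_mul]
      have : ((Q.filter fun q' => |m - q'| ≤ 1).card : ℝ) ≤ 3 := by
        exact_mod_cast card_filter_abs_sub_le_one Q m
      gcongr
    have h2 : ‖∑ q ∈ Q.filter (fun q => ¬ |m - q| ≤ 1), g q‖ ≤ ‖g m‖ := by
      have h3 : ∀ q ∈ Q.filter (fun q => ¬ |m - q| ≤ 1), ‖g q‖ ≤ ‖g m‖ / N := by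
        intro q hq
        obtain ⟨hq, hq'⟩ := Finset.mem_filter.1 hq
        rw [le_div_iff₀' (by linarith)]
        exact (hex q hq (not_le.1 hq')).le
      refine (norm_sum_le_of_le _ h3).trans ?_
      rw [Finset.sum_const, nsmul_eq_mul]
      have h4 : ((Q.filter fun q => ¬ |m - q| ≤ 1).card : ℝ) ≤ N :=
        le_trans (by exact_mod_cast Finset.card_filter_le _ _) hN
      calc _ ≤ N * (‖g m‖ / N) := by gcongr
        _ = ‖g m‖ := by field_simp
    have h5 : ‖∑ q ∈ Q, g q‖ ≤ 4 * ‖g m‖ := by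
      rw [← Finset.sum_filter_add_sum_filter_not Q (fun q => |m - q| ≤ 1)]
      refine (norm_add_le _ _).trans ?_
      linarith
    have h6 : ‖g m‖ ^ 6 ≤ ∑ q ∈ Q, ‖g q‖ ^ 6 :=
      Finset.single_le_sum (f := fun q => ‖g q‖ ^ 6) (fun _ _ => by positivity) hm
    calc ‖∑ q ∈ Q, g q‖ ^ 6 ≤ (4 * ‖g m‖) ^ 6 := by gcongr
      _ = 4 ^ 6 * ‖g m‖ ^ 6 := by ring
      _ ≤ 4 ^ 6 * _ := by gcongr
      _ ≤ _ := le_add_of_nonneg_right (by positivity)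

theorem DiamLE.card_image_floor_le {S : Finset ℤ} {L R : ℝ} (hS : DiamLE S L) (hR : 0 < R)
    (hL : 0 ≤ L) : ((S.image fun k : ℤ => ⌊(k : ℝ) / R⌋).card : ℝ) ≤ 2 * (L / R) + 3 := by
  have hLR : 0 ≤ L / R := by positivity
  rcases S.eq_empty_or_nonempty with rfl | ⟨k₀, hk₀⟩
  · simp
    linarith
  set m := ⌊L / R + 1⌋
  have hm : (m : ℝ) ≤ L / R + 1 := Int.floor_le _
  have hm0 : 0 ≤ m := Int.floor_nonneg.2 (by linarith)
  have hsub : (S.image fun k : ℤ => ⌊(k : ℝ) / R⌋) ⊆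
      Finset.Icc (⌊(k₀ : ℝ) / R⌋ - m) (⌊(k₀ : ℝ) / R⌋ + m) := by
    intro q hq
    obtain ⟨k, hk, rfl⟩ := Finset.mem_image.1 hq
    have h1 : |(k : ℝ) / R - k₀ / R| ≤ L / R := by
      rw [← sub_div, abs_div, abs_of_pos hR]
      exact div_le_div_of_nonneg_right (hS k hk k₀ hk₀) hR.le
    have h2 := abs_le.1 h1
    have a1 := Int.floor_le ((k : ℝ) / R)
    have a2 := Int.lt_floor_add_one ((k : ℝ) / R)
    have b1 := Int.floor_le ((k₀ : ℝ) / R)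
    have b2 := Int.lt_floor_add_one ((k₀ : ℝ) / R)
    have c1 : ⌊(k : ℝ) / R⌋ - ⌊(k₀ : ℝ) / R⌋ ≤ m := by
      refine Int.le_floor.2 ?_
      push_cast
      linarith [h2.2]
    have c2 : ⌊(k₀ : ℝ) / R⌋ - ⌊(k : ℝ) / R⌋ ≤ m := by
      refine Int.le_floor.2 ?_
      push_cast
      linarith [h2.1]
    rw [Finset.mem_Icc]
    constructor <;> linarith
  have h3 : ((S.image fun k : ℤ => ⌊(k : ℝ) / R⌋).card : ℤ) ≤ 2 * m + 1 := by
    have := Finset.card_le_card hsub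
    rw [Int.card_Icc] at this
    omega
  have h4 : ((S.image fun k : ℤ => ⌊(k : ℝ) / R⌋).card : ℝ) ≤ 2 * m + 1 := by exact_mod_cast h3
  linarith

theorem separated_of_floor_div {d : ℝ} (hd : 0 < d) (S : Finset ℤ) {q q' : ℤ}
    (h : 1 < |q - q'|) :
    Separated d (S.filter fun k : ℤ => ⌊(k : ℝ) / d⌋ = q)
      (S.filter fun k : ℤ => ⌊(k : ℝ) / d⌋ = q') := by
  have main : ∀ {q q' : ℤ}, q + 2 ≤ q' → ∀ k ∈ S.filter (fun k : ℤ => ⌊(k : ℝ) / d⌋ = q),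
      ∀ l ∈ S.filter (fun k : ℤ => ⌊(k : ℝ) / d⌋ = q'), (k : ℝ) + d ≤ l := by
    intro q q' hq k hk l hl
    have h1 := (Int.floor_eq_iff.1 (Finset.mem_filter.1 hk).2).2
    have h2 := (Int.floor_eq_iff.1 (Finset.mem_filter.1 hl).2).1
    have hq' : (q : ℝ) + 2 ≤ q' := by exact_mod_cast hq
    rw [div_lt_iff₀ hd] at h1
    rw [le_div_iff₀ hd] at h2
    nlinarith
  rcases lt_abs.1 h with h | h
  · exact Or.inr fun k hk l hl => main (by omega) l hl k hk
  · exact Or.inl (main (by omega))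

variable {B Λ : ℝ} {U : Set ℝ} {φ p : ℝ → ℝ}

/-- `∫ |F_S|⁶ ≤ D ‖F_S‖₂⁶` for all wave packets along `φ` and all `S ⊆ U` of diameter at
most `R`. -/
def SixBound (φ : ℝ → ℝ) (U : Set ℝ) (R D : ℝ) : Prop :=
  ∀ (F : ℤ → ℝ → ℂ) (e : ℤ → ℝ), WavePackets (fun k => φ k) F e → ∀ S : Finset ℤ,
    (∀ k ∈ S, (k : ℝ) ∈ U) → DiamLE S R → ∫ z, ‖modeSum F S z‖ ^ 6 ≤ D * (∑ k ∈ S, e k) ^ 3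

/-- `∫ |F_S|² |F_I|⁴ ≤ M ‖F_S‖₂² ‖F_I‖₂⁴` for sets `S` and `I` of diameter at most `d` and
`A`, at distance at least `d`. -/
def BilinearBound (φ : ℝ → ℝ) (U : Set ℝ) (d A M : ℝ) : Prop :=
  ∀ (F : ℤ → ℝ → ℂ) (e : ℤ → ℝ), WavePackets (fun k => φ k) F e → ∀ S I : Finset ℤ,
    (∀ k ∈ S, (k : ℝ) ∈ U) → (∀ k ∈ I, (k : ℝ) ∈ U) → DiamLE S d → DiamLE I A →
    Separated d S I → mixedIntegral F 2 4 S I ≤ M * (∑ k ∈ S, e k) * (∑ k ∈ I, e k) ^ 2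

theorem SixBound.mono {R D D' : ℝ} (h : SixBound φ U R D) (hD : D ≤ D') :
    SixBound φ U R D' := fun F e hF S hS hSR =>
  (h F e hF S hS hSR).trans (by have := hF.sum_energy_nonneg S; gcongr)

theorem BilinearBound.mono {d A M M' : ℝ} (h : BilinearBound φ U d A M) (hM : M ≤ M') :
    BilinearBound φ U d A M' := fun F e hF S I hS hI hSd hIA hsep =>
  (h F e hF S I hS hI hSd hIA hsep).trans (by
    have := hF.sum_energy_nonneg S
    have := hF.sum_energy_nonneg I
    gcongr)

/-- The start of the iteration, without any gain: `mixedIntegral_sq_le` used in both directions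
gives `y ^ 4 ≤ y * (X * Z ^ 2)`, which is Hölder's inequality once a factor `y > 0` is cancelled. -/
theorem SixBound.bilinearBound {d A D : ℝ} (h : SixBound φ U d D) (hAd : A ≤ d)
    (hD : 0 ≤ D) : BilinearBound φ U d A D := by
  intro F e hF S I hS hI hSd hIA hsep
  have hES := hF.sum_energy_nonneg S
  have hEI := hF.sum_energy_nonneg I
  have h1 := hF.mixedIntegral_sq_le S I
  have h2 := hF.mixedIntegral_sq_le I S
  have h3 := h F e hF S hS hSd
  have h4 := h F e hF I hI (hIA.mono subset_rfl hAd)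
  set y := mixedIntegral F 2 4 S I
  set y' := mixedIntegral F 2 4 I S
  set X := ∫ z, ‖modeSum F S z‖ ^ 6
  set Z := ∫ z, ‖modeSum F I z‖ ^ 6
  set ES := ∑ k ∈ S, e k
  set EI := ∑ k ∈ I, e k
  have hy : 0 ≤ y := mixedIntegral_nonneg _ _ _ _ _
  have hy' : 0 ≤ y' := mixedIntegral_nonneg _ _ _ _ _
  have hX : 0 ≤ X := integral_nonneg fun _ => by positivity
  have hZ : 0 ≤ Z := integral_nonneg fun _ => by positivity
  rcases hy.eq_or_lt with h0 | hpos
  · rw [← h0]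
    positivity
  have h5 : y * y ^ 3 ≤ y * (X * Z ^ 2) := by
    calc y * y ^ 3 = (y ^ 2) ^ 2 := by ring
      _ ≤ (y' * Z) ^ 2 := by gcongr
      _ = y' ^ 2 * Z ^ 2 := by ring
      _ ≤ (y * X) * Z ^ 2 := by gcongr
      _ = _ := by ring
  have h6 : y ^ 3 ≤ X * Z ^ 2 := le_of_mul_le_mul_left h5 hpos
  have h7 : y ^ 3 ≤ (D * ES * EI ^ 2) ^ 3 := by
    calc y ^ 3 ≤ X * Z ^ 2 := h6
      _ ≤ (D * ES ^ 3) * (D * EI ^ 3) ^ 2 := by gcongr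
      _ = _ := by ring
  exact le_of_pow_le_pow_left₀ (by norm_num) (by positivity) h7

/-- Orthogonality cuts `S` into pieces of length `R`. On each piece Cauchy–Schwarz swaps the roles:
the piece becomes the quartic set, controlled by `M`, with `I` as the quadratic one since `A ≤ d`;
the other factor `∫|F_I|⁶` is controlled by `D`. The result is linear in the energy of the piece, so
summing over pieces loses nothing. -/
theorem CurvedPhase.bilinearBound_step (H : CurvedPhase B Λ U φ p) {d A R M D : ℝ}
    (hd : 0 < d) (hA : 1 ≤ A) (hAd : A ≤ d) (hR : R = (4 * B + 6) * A ^ 2 / d) (hM : 0 ≤ M)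
    (hD : 0 ≤ D) (h6 : SixBound φ U A D) (hM' : BilinearBound φ U d R M) :
    BilinearBound φ U d A (3 * √(M * D)) := by
  intro F e hF S I hS hI hSd hIA hsep
  have hB := H.one_le_ratio
  have hR0 : 0 < R := by rw [hR]; positivity
  have hEI := hF.sum_energy_nonneg I
  have key := H.mixedIntegral_le hF hd hA hR hS hI hsep hIA
  have hpiece : ∀ q, mixedIntegral F 2 4 (S.filter fun k : ℤ => ⌊(k : ℝ) / R⌋ = q) I ≤
      √(M * D) * (∑ k ∈ I, e k) ^ 2 * ∑ k ∈ S.filter (fun k : ℤ => ⌊(k : ℝ) / R⌋ = q), e k := by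
    intro q
    set J := S.filter fun k : ℤ => ⌊(k : ℝ) / R⌋ = q
    have hJS : J ⊆ S := Finset.filter_subset _ _
    have hEJ := hF.sum_energy_nonneg J
    have h1 := hF.mixedIntegral_sq_le J I
    have h2 := hM' F e hF I J hI (fun k hk => hS k (hJS hk)) (hIA.mono subset_rfl hAd)
      (diamLE_fiber S hR0 q) (hsep.symm.mono subset_rfl hJS)
    have h3 := h6 F e hF I hI hIA
    refine le_of_sq_le_sq ?_ (by positivity)
    have hZ : 0 ≤ ∫ z, ‖modeSum F I z‖ ^ 6 := integral_nonneg fun _ => by positivity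
    calc _ ≤ _ := h1
      _ ≤ (M * (∑ k ∈ I, e k) * (∑ k ∈ J, e k) ^ 2) * (D * (∑ k ∈ I, e k) ^ 3) := by gcongr
      _ = (M * D) * ((∑ k ∈ I, e k) ^ 2 * ∑ k ∈ J, e k) ^ 2 := by ring
      _ = _ := by rw [mul_assoc (√(M * D)), mul_pow (√(M * D)), Real.sq_sqrt (by positivity)]
  refine key.trans ?_
  calc _ ≤ 3 * ∑ q ∈ S.image (fun k : ℤ => ⌊(k : ℝ) / R⌋), √(M * D) * (∑ k ∈ I, e k) ^ 2 *
        ∑ k ∈ S.filter (fun k : ℤ => ⌊(k : ℝ) / R⌋ = q), e k := by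
        gcongr with q
        exact hpiece q
    _ = _ := by
        rw [← Finset.mul_sum, sum_fiberwise_image]
        ring

/-- Writing `A = d / (4 * B + 6) * q` turns the next scale `(4 * B + 6) * A ^ 2 / d` into the same
expression with `q ^ 2`. The size condition keeps every scale used at least `1`. Each step gains `q
^ (lam / 2)` from the linear bound at the small scale `A`, and `9` is the fixed point of `x ↦ 3 *
√x`. -/
theorem CurvedPhase.bilinearBound_iterate (H : CurvedPhase B Λ U φ p) {d C lam : ℝ}
    (hC : 0 ≤ C) (hlam : 0 ≤ lam) (h6 : ∀ R, 1 ≤ R → SixBound φ U R (C * R ^ lam)) (n : ℕ) :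
    ∀ q : ℝ, 0 < q → q ≤ 1 → 1 ≤ d / (4 * B + 6) * q ^ 2 ^ n →
      BilinearBound φ U d (d / (4 * B + 6) * q) (9 * C * d ^ lam * q ^ (lam * n / 2)) := by
  have hB := H.one_le_ratio
  have hc : 1 ≤ 4 * B + 6 := by linarith
  have hsize : ∀ (n : ℕ) (q : ℝ), 0 < q → q ≤ 1 → 1 ≤ d / (4 * B + 6) * q ^ 2 ^ n →
      1 ≤ d / (4 * B + 6) * q ∧ d / (4 * B + 6) * q ≤ d ∧ 1 ≤ d := by
    intro n q hq hq1 hn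
    have hd0 : 0 < d / (4 * B + 6) := by
      by_contra hneg
      have := mul_nonpos_of_nonpos_of_nonneg (not_lt.1 hneg) (pow_nonneg hq.le (2 ^ n))
      linarith
    have hd : 0 < d := by
      rw [div_pos_iff_of_pos_right (by linarith)] at hd0
      exact hd0
    have h1 : q ^ 2 ^ n ≤ q := pow_le_of_le_one hq.le hq1 (by positivity)
    have h2 : 1 ≤ d / (4 * B + 6) * q := hn.trans (by gcongr)
    have h3 : d / (4 * B + 6) * q ≤ d :=
      (mul_le_of_le_one_right hd0.le hq1).trans (div_le_self hd.le hc)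
    exact ⟨h2, h3, h2.trans h3⟩
  induction n with
  | zero =>
    intro q hq hq1 hn
    obtain ⟨h1, h2, h3⟩ := hsize 0 q hq hq1 hn
    refine ((h6 d h3).bilinearBound h2 (by positivity)).mono ?_
    have : 0 ≤ C * d ^ lam := by positivity
    simp only [Nat.cast_zero, mul_zero, zero_div, Real.rpow_zero, mul_one]
    linarith
  | succ n ih =>
    intro q hq hq1 hn
    obtain ⟨h1, h2, h3⟩ := hsize (n + 1) q hq hq1 hn
    have hd : 0 < d := by linarith
    have hn' : 1 ≤ d / (4 * B + 6) * (q ^ 2) ^ 2 ^ n := by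
      rwa [← pow_mul, ← pow_succ']
    have h4 := ih (q ^ 2) (by positivity) (pow_le_one₀ hq.le hq1) hn'
    have h5 := H.bilinearBound_step hd h1 h2 (R := d / (4 * B + 6) * q ^ 2)
      (by field_simp) (by positivity) (by positivity) (h6 _ h1) h4
    refine h5.mono ?_
    have e1 : (d / (4 * B + 6) * q) ^ lam ≤ d ^ lam * q ^ lam := by
      rw [← Real.mul_rpow hd.le hq.le]
      refine Real.rpow_le_rpow (by positivity) ?_ hlam
      gcongr
      exact div_le_self hd.le hc
    have e2 : (q ^ 2) ^ (lam * n / 2) * q ^ lam = (q ^ (lam * (n + 1 : ℕ) / 2)) ^ 2 := by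
      rw [← Real.rpow_natCast q 2, ← Real.rpow_mul hq.le, ← Real.rpow_add hq,
        ← Real.rpow_natCast _ 2, ← Real.rpow_mul hq.le]
      congr 1
      push_cast
      ring
    have e3 : (9 * C * d ^ lam * (q ^ 2) ^ (lam * n / 2)) * (C * (d / (4 * B + 6) * q) ^ lam) ≤
        (3 * C * d ^ lam * q ^ (lam * (n + 1 : ℕ) / 2)) ^ 2 := by
      calc _ ≤ (9 * C * d ^ lam * (q ^ 2) ^ (lam * n / 2)) * (C * (d ^ lam * q ^ lam)) := by
            gcongr
        _ = (3 * C * d ^ lam) ^ 2 * ((q ^ 2) ^ (lam * n / 2) * q ^ lam) := by ring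
        _ = _ := by rw [e2]; ring
    have e4 := Real.sqrt_le_sqrt e3
    rw [Real.sqrt_sq (by positivity)] at e4
    linarith

/-- `S` falls into at most `5 * K` pieces of length `d`, to which `norm_sum_pow_six_le` applies. In
a separated pair the quartic piece is cut again into at most `5 * c * K` pieces of length `A`, and
Hölder costs the cube of their number. The total loss `K ^ 13` is affordable because
`bilinearBound_iterate` gains an arbitrarily high power of `K⁻¹`. -/
theorem sixBound_of_bilinearBound {L K d A D M c : ℝ} (hK : 1 ≤ K) (hc : 1 ≤ c)
    (hd : 0 < d) (hL : L = K * d) (hA : A = d / c * K⁻¹) (hM : 0 ≤ M) (hD : 0 ≤ D)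
    (h6 : SixBound φ U d D) (hb : BilinearBound φ U d A M) :
    SixBound φ U L (4 ^ 6 * D + (5 * K) ^ 10 * (5 * c * K) ^ 3 * M) := by
  intro F e hF S hS hSL
  have hA0 : 0 < A := by rw [hA]; positivity
  have hL0 : 0 ≤ L := by rw [hL]; positivity
  let f : ℤ → ℤ := fun k => ⌊(k : ℝ) / d⌋
  let g : ℤ → ℤ := fun k => ⌊(k : ℝ) / A⌋
  let G : ℤ → Finset ℤ := fun q => S.filter fun k => f k = q
  let Q := S.image f
  have hGS : ∀ q, G q ⊆ S := fun q => Finset.filter_subset _ _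
  have hGd : ∀ q, DiamLE (G q) d := fun q => diamLE_fiber S hd q
  have hcard : ((Q.card : ℕ) : ℝ) ≤ 5 * K := by
    have := hSL.card_image_floor_le hd hL0
    rw [hL, mul_div_cancel_right₀ _ hd.ne'] at this
    exact this.trans (by linarith)
  have hcard' : ∀ q, (((G q).image g).card : ℝ) ≤ 5 * c * K := by
    intro q
    have h1 := (hGd q).card_image_floor_le hA0 hd.le
    have h2 : d / A = c * K := by
      rw [hA]
      field_simp
    rw [h2] at h1
    have h3 : 1 ≤ c * K := one_le_mul_of_one_le_of_one_le hc hK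
    exact h1.trans (by linarith)
  have hE : ∑ q ∈ Q, ∑ k ∈ G q, e k = ∑ k ∈ S, e k := sum_fiberwise_image e S f
  have hEn : ∀ T : Finset ℤ, 0 ≤ ∑ k ∈ T, e k := hF.sum_energy_nonneg
  -- the interaction of two separated coarse pieces
  have hfar : ∀ q q', 1 < |q - q'| → mixedIntegral F 2 4 (G q) (G q') ≤
      (5 * c * K) ^ 3 * M * (∑ k ∈ G q, e k) * (∑ k ∈ G q', e k) ^ 2 := by
    intro q q' hqq
    have hsep : Separated d (G q) (G q') := separated_of_floor_div hd S hqq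
    have hpt : mixedIntegral F 2 4 (G q) (G q') ≤ (5 * c * K) ^ 3 * ∑ i ∈ (G q').image g,
        mixedIntegral F 2 4 (G q) ((G q').filter fun k => g k = i) := by
      simp only [mixedIntegral]
      rw [← integral_finsetSum _ fun i _ => hF.integrable_pow_mul_pow _ _ le_rfl,
        ← integral_const_mul]
      refine integral_mono (hF.integrable_pow_mul_pow _ _ le_rfl)
        ((integrable_finsetSum _ fun i _ => hF.integrable_pow_mul_pow _ _ le_rfl).const_mul _)
        fun z => ?_
      simp only
      rw [modeSum_fiberwise F (G q') g z, ← Finset.mul_sum]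
      have h1 := norm_sum_pow_succ_le ((G q').image g)
        (fun i => modeSum F ((G q').filter fun k => g k = i) z) 3
      have h2 := hcard' q'
      calc _ ≤ ‖modeSum F (G q) z‖ ^ 2 * ((((G q').image g).card : ℝ) ^ 3 *
            ∑ i ∈ (G q').image g, ‖modeSum F ((G q').filter fun k => g k = i) z‖ ^ 4) := by
            gcongr
        _ ≤ ‖modeSum F (G q) z‖ ^ 2 * ((5 * c * K) ^ 3 *
            ∑ i ∈ (G q').image g, ‖modeSum F ((G q').filter fun k => g k = i) z‖ ^ 4) := by
            gcongr
        _ = _ := by ring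
    refine hpt.trans ?_
    have hfine : ∀ i, mixedIntegral F 2 4 (G q) ((G q').filter fun k => g k = i) ≤
        M * (∑ k ∈ G q, e k) * (∑ k ∈ (G q').filter (fun k => g k = i), e k) ^ 2 := fun i =>
      hb F e hF _ _ (fun k hk => hS k (hGS q hk))
        (fun k hk => hS k (hGS q' (Finset.filter_subset _ _ hk))) (hGd q)
        (diamLE_fiber (G q') hA0 i) (hsep.mono subset_rfl (Finset.filter_subset _ _))
    calc _ ≤ (5 * c * K) ^ 3 * ∑ i ∈ (G q').image g, M * (∑ k ∈ G q, e k) *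
          (∑ k ∈ (G q').filter (fun k => g k = i), e k) ^ 2 := by
          gcongr with i
          exact hfine i
      _ = (5 * c * K) ^ 3 * M * (∑ k ∈ G q, e k) * ∑ i ∈ (G q').image g,
          (∑ k ∈ (G q').filter (fun k => g k = i), e k) ^ 2 := by
          rw [← Finset.mul_sum]
          ring
      _ ≤ (5 * c * K) ^ 3 * M * (∑ k ∈ G q, e k) * (∑ i ∈ (G q').image g,
          ∑ k ∈ (G q').filter (fun k => g k = i), e k) ^ 2 := by
          have h3 := hEn (G q)
          gcongr
          exact sum_pow_succ_le_pow_sum _ _ (fun i _ => hEn _) 1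
      _ = _ := by rw [sum_fiberwise_image]
  have hint : ∀ q q', Integrable fun z =>
      ‖modeSum F (G q) z‖ ^ 2 * ‖modeSum F (G q') z‖ ^ 4 := fun q q' =>
    hF.integrable_pow_mul_pow _ _ le_rfl
  have hint6 : ∀ T, Integrable fun z => ‖modeSum F T z‖ ^ 6 := fun T =>
    hF.integrable_pow T (by norm_num)
  have hmain : ∫ z, ‖modeSum F S z‖ ^ 6 ≤ 4 ^ 6 * ∑ q ∈ Q, (∫ z, ‖modeSum F (G q) z‖ ^ 6) +
      (5 * K) ^ 10 * ∑ q ∈ Q, ∑ q' ∈ Q.filter (fun q' => 1 < |q - q'|),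
        mixedIntegral F 2 4 (G q) (G q') := by
    simp only [mixedIntegral]
    simp_rw [← integral_finsetSum _ fun q' _ => hint _ q']
    rw [← integral_finsetSum _ fun q _ => integrable_finsetSum _ fun q' _ => hint q q',
      ← integral_finsetSum _ fun q _ => hint6 (G q), ← integral_const_mul, ← integral_const_mul,
      ← integral_add ((integrable_finsetSum _ fun q _ => hint6 (G q)).const_mul _)
        ((integrable_finsetSum _ fun q _ => integrable_finsetSum _ fun q' _ =>
          hint q q').const_mul _)]
    refine integral_mono (hint6 S)
      (((integrable_finsetSum _ fun q _ => hint6 (G q)).const_mul _).add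
        ((integrable_finsetSum _ fun q _ => integrable_finsetSum _ fun q' _ =>
          hint q q').const_mul _)) fun z => ?_
    simp only
    rw [modeSum_fiberwise F S f z]
    exact norm_sum_pow_six_le Q (fun q => modeSum F (G q) z) hcard
  refine hmain.trans ?_
  have hA' : ∑ q ∈ Q, ∫ z, ‖modeSum F (G q) z‖ ^ 6 ≤ D * (∑ k ∈ S, e k) ^ 3 := by
    calc _ ≤ ∑ q ∈ Q, D * (∑ k ∈ G q, e k) ^ 3 := Finset.sum_le_sum fun q _ =>
          h6 F e hF _ (fun k hk => hS k (hGS q hk)) (hGd q)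
      _ ≤ D * (∑ q ∈ Q, ∑ k ∈ G q, e k) ^ 3 := by
          rw [← Finset.mul_sum]
          gcongr
          exact sum_pow_succ_le_pow_sum _ _ (fun i _ => hEn _) 2
      _ = _ := by rw [hE]
  have hB' : ∑ q ∈ Q, ∑ q' ∈ Q.filter (fun q' => 1 < |q - q'|),
      mixedIntegral F 2 4 (G q) (G q') ≤ (5 * c * K) ^ 3 * M * (∑ k ∈ S, e k) ^ 3 := by
    calc _ ≤ ∑ q ∈ Q, ∑ q' ∈ Q, (5 * c * K) ^ 3 * M * (∑ k ∈ G q, e k) *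
            (∑ k ∈ G q', e k) ^ 2 := by
          refine Finset.sum_le_sum fun q _ => ?_
          refine (Finset.sum_le_sum fun q' hq' => hfar q q' (Finset.mem_filter.1 hq').2).trans ?_
          refine Finset.sum_le_sum_of_subset_of_nonneg (Finset.filter_subset _ _)
            fun q' _ _ => ?_
          have := hEn (G q)
          positivity
      _ = (5 * c * K) ^ 3 * M * (∑ q ∈ Q, ∑ k ∈ G q, e k) *
            ∑ q' ∈ Q, (∑ k ∈ G q', e k) ^ 2 := by
          simp only [← Finset.mul_sum, ← Finset.sum_mul]
      _ ≤ (5 * c * K) ^ 3 * M * (∑ q ∈ Q, ∑ k ∈ G q, e k) *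
            (∑ q' ∈ Q, ∑ k ∈ G q', e k) ^ 2 := by
          have : 0 ≤ ∑ q ∈ Q, ∑ k ∈ G q, e k := Finset.sum_nonneg fun q _ => hEn _
          gcongr
          exact sum_pow_succ_le_pow_sum _ _ (fun i _ => hEn _) 1
      _ = _ := by rw [hE]; ring
  calc _ ≤ 4 ^ 6 * (D * (∑ k ∈ S, e k) ^ 3) +
        (5 * K) ^ 10 * ((5 * c * K) ^ 3 * M * (∑ k ∈ S, e k) ^ 3) := by gcongr
    _ = _ := by ring

end

/-! ### Growth exponents: the trivial bound and its improvement. -/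

section

variable {ψ : ℤ → ℝ} {F : ℤ → ℝ → ℂ} {e : ℤ → ℝ}

/-- Hölder over the modes, then the sup bound on four of the six factors; the constant is `4` times
the length `2π` of the torus. -/
theorem WavePackets.integral_pow_six_le (h : WavePackets ψ F e) (S : Finset ℤ) :
    ∫ z, ‖modeSum F S z‖ ^ 6 ≤ 8 * Real.pi * (S.card : ℝ) ^ 5 * (∑ k ∈ S, e k) ^ 3 := by
  have hpt : ∀ z : Torus × ℝ, ‖modeSum F S z‖ ^ 6 ≤
      (S.card : ℝ) ^ 5 * ∑ k ∈ S, 4 * e k ^ 2 * ‖F k z.2‖ ^ 2 := by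
    intro z
    refine (norm_sum_pow_succ_le S (fun k => fourier k z.1 * F k z.2) 5).trans ?_
    gcongr with k
    rw [norm_mul, norm_fourier_apply, one_mul]
    calc ‖F k z.2‖ ^ (5 + 1) = (‖F k z.2‖ ^ 2) ^ 2 * ‖F k z.2‖ ^ 2 := by ring
      _ ≤ (2 * e k) ^ 2 * ‖F k z.2‖ ^ 2 := by
        gcongr
        exact h.sq_le k z.2
      _ = _ := by ring
  have hk : ∀ k, Integrable (fun z : Torus × ℝ => 4 * e k ^ 2 * ‖F k z.2‖ ^ 2) := fun k =>
    ((h.integrable_sq k).comp_snd (volume : Measure Torus)).const_mul _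
  refine (integral_mono (h.integrable_pow S (by norm_num))
    ((integrable_finsetSum S fun k _ => hk k).const_mul _) hpt).trans ?_
  rw [integral_const_mul, integral_finsetSum S fun k _ => hk k]
  have hone : ∀ k, ∫ z : Torus × ℝ, 4 * e k ^ 2 * ‖F k z.2‖ ^ 2 ≤ 8 * Real.pi * e k ^ 3 := by
    intro k
    have h1 := integral_prod_mul (μ := (volume : Measure Torus)) (ν := (volume : Measure ℝ))
      (fun _ : Torus => (1 : ℝ)) (fun t => ‖F k t‖ ^ 2)
    simp only [one_mul] at h1
    rw [integral_const_mul, Measure.volume_eq_prod, h1]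
    have h2 : ∫ _ : Torus, (1 : ℝ) = 2 * Real.pi := by
      simp [Measure.real, Real.pi_pos.le]
    rw [h2]
    calc 4 * e k ^ 2 * (2 * Real.pi * ∫ t, ‖F k t‖ ^ 2)
        ≤ 4 * e k ^ 2 * (2 * Real.pi * e k) := by
          have := Real.pi_pos
          gcongr
          exact h.integral_le k
      _ = _ := by ring
  have hpi := Real.pi_pos
  calc _ ≤ (S.card : ℝ) ^ 5 * ∑ k ∈ S, 8 * Real.pi * e k ^ 3 := by
        gcongr with k
        exact hone k
    _ = 8 * Real.pi * (S.card : ℝ) ^ 5 * ∑ k ∈ S, e k ^ 3 := by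
        rw [← Finset.mul_sum]
        ring
    _ ≤ _ := by
        gcongr
        exact sum_pow_succ_le_pow_sum _ _ (fun k _ => h.energy_nonneg k) 2

theorem DiamLE.card_le {S : Finset ℤ} {L : ℝ} (hS : DiamLE S L) (hL : 0 ≤ L) :
    (S.card : ℝ) ≤ 2 * L + 3 := by
  have := hS.card_image_floor_le one_pos hL
  simpa using this

theorem sixBound_trivial (φ : ℝ → ℝ) (U : Set ℝ) {L : ℝ} (hL : 0 ≤ L) :
    SixBound φ U L (8 * Real.pi * (2 * L + 3) ^ 5) := by
  intro F e hF S _ hSL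
  have hpi := Real.pi_pos
  have hE := hF.sum_energy_nonneg S
  have hc := hSL.card_le hL
  refine (hF.integral_pow_six_le S).trans ?_
  gcongr

/-- The sixth power of the `L²`-to-`L⁶` constant grows at most like `R ^ lam`, uniformly over all
phases with curvature ratio `B`. -/
def GrowthExponent (B lam : ℝ) : Prop :=
  ∃ C : ℝ, 0 ≤ C ∧ ∀ (Λ : ℝ) (U : Set ℝ) (φ p : ℝ → ℝ), CurvedPhase B Λ U φ p →
    ∀ R, 1 ≤ R → SixBound φ U R (C * R ^ lam)

theorem growthExponent_five (B : ℝ) : GrowthExponent B 5 := by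
  refine ⟨8 * Real.pi * 5 ^ 5, by positivity, fun Λ U φ p _ R hR => ?_⟩
  refine (sixBound_trivial φ U (by linarith)).mono ?_
  have h5 : R ^ (5 : ℝ) = R ^ (5 : ℕ) := by exact_mod_cast Real.rpow_natCast R 5
  rw [h5, mul_assoc, mul_assoc, ← mul_pow, ← mul_assoc]
  gcongr
  linarith

theorem GrowthExponent.mono {B lam lam' : ℝ} (h : GrowthExponent B lam) (hl : lam ≤ lam') :
    GrowthExponent B lam' := by
  obtain ⟨C, hC, h⟩ := h
  refine ⟨C, hC, fun Λ U φ p H R hR => (h Λ U φ p H R hR).mono ?_⟩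
  gcongr

/-- Take `K = L ^ κ` and `d = L / K`. The choice of `κ` makes `d = K ^ (2 ^ n + 1)`, so after `n`
squarings the scale is still `K / c ≥ 1`, provided `L ≥ c ^ (1 / κ)`; smaller `L` are covered by the
trivial bound. The hypothesis `28 ≤ lam * n` yields a gain of `K⁻¹ ^ 14`, which beats the loss `K ^
13`, and what remains is `d ^ lam = L ^ (lam * (1 - κ))`. -/
theorem GrowthExponent.improve {B lam : ℝ} (hB : 1 ≤ B) (hlam : 0 ≤ lam) {n : ℕ}
    (hn : 28 ≤ lam * n) (h : GrowthExponent B lam) :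
    GrowthExponent B (lam * (1 - 1 / (2 ^ n + 2))) := by
  obtain ⟨C, hC, h⟩ := h
  set c := 4 * B + 6
  have hc : 1 ≤ c := by simp only [c]; linarith
  set κ : ℝ := 1 / (2 ^ n + 2) with hκ
  have hκ0 : 0 < κ := by positivity
  have hκn : κ * (2 ^ n + 2) = 1 := by rw [hκ]; field_simp
  have hκ1 : κ ≤ 1 := by
    have : (0 : ℝ) < 2 ^ n := by positivity
    nlinarith
  set L₀ := c ^ (1 / κ)
  have hL₀ : 0 ≤ L₀ := by positivity
  set C₁ := C * (4 ^ 6 + 9 * 5 ^ 13 * c ^ 3)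
  have hC₁ : 0 ≤ C₁ := by positivity
  set C₂ := 8 * Real.pi * (2 * L₀ + 3) ^ 5
  have hC₂ : 0 ≤ C₂ := by have := Real.pi_pos; positivity
  refine ⟨C₁ + C₂, by positivity, fun Λ U φ p H L hL => ?_⟩
  have hL0 : 0 < L := by linarith
  rcases lt_or_ge L L₀ with hlt | hge
  · refine (sixBound_trivial φ U hL0.le).mono ?_
    have h1 : 1 ≤ L ^ (lam * (1 - κ)) :=
      Real.one_le_rpow hL (mul_nonneg hlam (by linarith))
    have hpi := Real.pi_pos
    calc 8 * Real.pi * (2 * L + 3) ^ 5 ≤ C₂ := by simp only [C₂]; gcongr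
      _ ≤ C₁ + C₂ := by linarith
      _ ≤ _ := le_mul_of_one_le_right (by positivity) h1
  · set K := L ^ κ with hK
    have hcK : c ≤ K := by
      have := Real.rpow_le_rpow (by positivity) hge hκ0.le
      rwa [← Real.rpow_mul (by positivity), one_div_mul_cancel hκ0.ne', Real.rpow_one] at this
    have hK1 : 1 ≤ K := hc.trans hcK
    have hK0 : 0 < K := by linarith
    set d := L ^ (1 - κ) with hd
    have hd0 : 0 < d := by positivity
    have hLKd : L = K * d := by
      rw [hK, hd, ← Real.rpow_add hL0]
      simp
    have hsmall : 1 ≤ d / c * K⁻¹ ^ 2 ^ n := by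
      have e1 : d = K * K ^ 2 ^ n := by
        rw [hK, hd, ← Real.rpow_natCast _ (2 ^ n), ← Real.rpow_mul hL0.le, ← Real.rpow_add hL0]
        congr 1
        push_cast
        linarith
      rw [e1, inv_pow, div_mul_eq_mul_div, mul_assoc, mul_inv_cancel₀ (by positivity), mul_one,
        le_div_iff₀ (by linarith)]
      linarith
    have hd1 : 1 ≤ d := Real.one_le_rpow hL (by linarith)
    have hb := H.bilinearBound_iterate hC hlam (fun R hR => h Λ U φ p H R hR) n K⁻¹
      (by positivity) (inv_le_one_of_one_le₀ hK1) hsmall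
    have h6 := sixBound_of_bilinearBound hK1 hc hd0 hLKd rfl (by positivity) (by positivity)
      (h Λ U φ p H d hd1) hb
    refine h6.mono ?_
    have e2 : K⁻¹ ^ (lam * n / 2) ≤ K⁻¹ ^ 14 := by
      rw [← Real.rpow_natCast K⁻¹ 14]
      refine Real.rpow_le_rpow_of_exponent_ge (by positivity) (inv_le_one_of_one_le₀ hK1) ?_
      push_cast
      linarith
    have e3 : (5 * K) ^ 10 * (5 * c * K) ^ 3 * K⁻¹ ^ 14 ≤ 5 ^ 13 * c ^ 3 := by
      have : (5 * K) ^ 10 * (5 * c * K) ^ 3 * K⁻¹ ^ 14 = 5 ^ 13 * c ^ 3 * K⁻¹ := by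
        field_simp
      rw [this]
      exact mul_le_of_le_one_right (by positivity) (inv_le_one_of_one_le₀ hK1)
    have e4 : d ^ lam = L ^ (lam * (1 - κ)) := by
      rw [hd, ← Real.rpow_mul hL0.le, mul_comm]
    calc 4 ^ 6 * (C * d ^ lam) + (5 * K) ^ 10 * (5 * c * K) ^ 3 *
          (9 * C * d ^ lam * K⁻¹ ^ (lam * n / 2))
        ≤ 4 ^ 6 * (C * d ^ lam) + (5 * K) ^ 10 * (5 * c * K) ^ 3 *
          (9 * C * d ^ lam * K⁻¹ ^ 14) := by gcongr
      _ = 4 ^ 6 * (C * d ^ lam) +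
          9 * C * d ^ lam * ((5 * K) ^ 10 * (5 * c * K) ^ 3 * K⁻¹ ^ 14) := by ring
      _ ≤ 4 ^ 6 * (C * d ^ lam) + 9 * C * d ^ lam * (5 ^ 13 * c ^ 3) := by gcongr
      _ = C₁ * d ^ lam := by simp only [C₁]; ring
      _ ≤ (C₁ + C₂) * d ^ lam := by gcongr; linarith
      _ = _ := by rw [e4]

/-- The maximum with the target `lam` keeps every exponent at least `lam`, so a single `n`, hence a
single `κ`, serves all rounds and the decrease from `5` is geometric. -/
theorem growthExponent_of_pos {B lam : ℝ} (hB : 1 ≤ B) (hlam : 0 < lam) :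
    GrowthExponent B lam := by
  obtain ⟨n, hn⟩ := exists_nat_ge (28 / lam)
  rw [div_le_iff₀' hlam] at hn
  set κ : ℝ := 1 / (2 ^ n + 2)
  have hκ0 : 0 < κ := by positivity
  have hκ1 : κ < 1 := by
    rw [div_lt_one (by positivity)]
    have : (0 : ℝ) < 2 ^ n := by positivity
    linarith
  have hiter : ∀ i : ℕ, GrowthExponent B (max lam (5 * (1 - κ) ^ i)) := by
    intro i
    induction i with
    | zero => exact (growthExponent_five B).mono (by simp)
    | succ i ih =>
      have hm : lam ≤ max lam (5 * (1 - κ) ^ i) := le_max_left _ _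
      refine (ih.improve hB (hlam.le.trans hm) (n := n)
        (hn.trans (by gcongr))).mono ?_
      rw [max_mul_of_nonneg _ _ (by linarith)]
      refine max_le_max ?_ (le_of_eq ?_)
      · exact mul_le_of_le_one_right hlam.le (by linarith)
      · rw [pow_succ]
        ring
  obtain ⟨i, hi⟩ := exists_pow_lt_of_lt_one (show 0 < lam / 5 by positivity)
    (show 1 - κ < 1 by linarith)
  refine (hiter i).mono (max_le le_rfl ?_)
  linarith

end

/-! ### Curvature of the dispersion relation and dyadic blocks. -/

/-- The dispersion relation, in the normalisation `e^{2πiξt}` of the Fourier transform. -/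
def phase (α β x : ℝ) : ℝ := (-α * x ^ 5 + β * x ^ 3) / (2 * Real.pi)

/-- The increment of the derivative factors as `(x - y) * (x + y) * (-5 * α * (x ^ 2 + y ^ 2) + 3 *
β) / (2 * π)`. Equal signs keep `|x + y|` between `2 * X` and `4 * X`; `hβ` makes the `β` term at
most half of the `α` term, so the last bracket lies between `5 * |α| * X ^ 2` and `45 * |α| * X ^
2`. The ratio is `4 * 45 / (2 * 5) = 18`, and `hα` makes the curvature at least `1`. -/
theorem curvedPhase_of_abs_bounds {α β m X : ℝ} (hX : 1 ≤ X)
    (hβ : 3 * |β| ≤ 5 * |α| * X ^ 2) (hα : 2 * Real.pi ≤ 10 * |α| * X ^ 3) {U : Set ℝ}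
    (hU : U.OrdConnected) (hUX : ∀ x ∈ U, X ≤ |x| ∧ |x| ≤ 2 * X)
    (hsign : ∀ x ∈ U, ∀ y ∈ U, |x + y| = |x| + |y|) :
    CurvedPhase 18 (10 * |α| * X ^ 3 / (2 * Real.pi)) U (fun x => phase α β x + m)
      (fun x => (-5 * α * x ^ 4 + 3 * β * x ^ 2) / (2 * Real.pi)) := by
  have hpi := Real.two_pi_pos
  have hfac : ∀ x y : ℝ, |(-5 * α * x ^ 4 + 3 * β * x ^ 2) / (2 * Real.pi) -
      (-5 * α * y ^ 4 + 3 * β * y ^ 2) / (2 * Real.pi)| =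
      |x + y| * |-5 * α * (x ^ 2 + y ^ 2) + 3 * β| / (2 * Real.pi) * |x - y| := by
    intro x y
    rw [← sub_div, abs_div, abs_of_pos hpi, ← abs_mul, div_mul_eq_mul_div, ← abs_mul]
    congr 2
    ring
  have hbd : ∀ x ∈ U, ∀ y ∈ U, (2 * X ≤ |x + y| ∧ |x + y| ≤ 4 * X) ∧
      5 * |α| * X ^ 2 ≤ |-5 * α * (x ^ 2 + y ^ 2) + 3 * β| ∧
      |-5 * α * (x ^ 2 + y ^ 2) + 3 * β| ≤ 45 * |α| * X ^ 2 := by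
    intro x hx y hy
    obtain ⟨hx1, hx2⟩ := hUX x hx
    obtain ⟨hy1, hy2⟩ := hUX y hy
    have a1 : X ^ 2 ≤ x ^ 2 := by rw [← sq_abs x]; gcongr
    have a2 : X ^ 2 ≤ y ^ 2 := by rw [← sq_abs y]; gcongr
    have a3 : x ^ 2 ≤ (2 * X) ^ 2 := by rw [← sq_abs x]; gcongr
    have a4 : y ^ 2 ≤ (2 * X) ^ 2 := by rw [← sq_abs y]; gcongr
    have e1 : |-5 * α * (x ^ 2 + y ^ 2)| = 5 * |α| * (x ^ 2 + y ^ 2) := by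
      rw [abs_mul, abs_mul, abs_of_nonneg (by positivity : 0 ≤ x ^ 2 + y ^ 2)]
      norm_num
    have e2 : |3 * β| = 3 * |β| := by rw [abs_mul]; norm_num
    have b1 := abs_add_le (-5 * α * (x ^ 2 + y ^ 2)) (3 * β)
    have b2 := abs_sub_abs_le_abs_add (-5 * α * (x ^ 2 + y ^ 2)) (3 * β)
    have c1 : |α| * (2 * X ^ 2) ≤ |α| * (x ^ 2 + y ^ 2) := by gcongr; linarith
    have c2 : |α| * (x ^ 2 + y ^ 2) ≤ |α| * (8 * X ^ 2) := by gcongr; linarith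
    refine ⟨?_, ?_, ?_⟩
    · rw [hsign x hx y hy]
      constructor <;> linarith
    · linarith
    · linarith
  refine ⟨by norm_num, (one_le_div hpi).2 hα, hU, fun x _ => ?_, fun x hx y hy => ?_,
    fun x hx y hy => ?_⟩
  · have h1 := ((((hasDerivAt_pow 5 x).const_mul (-α)).add
      ((hasDerivAt_pow 3 x).const_mul β)).div_const (2 * Real.pi)).add_const m
    refine h1.congr_deriv ?_
    push_cast
    ring
  · obtain ⟨⟨h1, h2⟩, h3, h4⟩ := hbd x hx y hy
    rw [hfac]
    refine mul_le_mul_of_nonneg_right (div_le_div_of_nonneg_right ?_ hpi.le) (abs_nonneg _)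
    calc 10 * |α| * X ^ 3 = (2 * X) * (5 * |α| * X ^ 2) := by ring
      _ ≤ _ := by gcongr
  · obtain ⟨⟨h1, h2⟩, h3, h4⟩ := hbd x hx y hy
    rw [hfac, ← mul_div_assoc]
    refine mul_le_mul_of_nonneg_right (div_le_div_of_nonneg_right ?_ hpi.le) (abs_nonneg _)
    calc |x + y| * |-5 * α * (x ^ 2 + y ^ 2) + 3 * β| ≤ (4 * X) * (45 * |α| * X ^ 2) := by gcongr
      _ = _ := by ring

/-- The dyadic block of a frequency: its size and its sign. -/
def dyadicBlock (k : ℤ) : ℕ × Bool := (Nat.log 2 k.natAbs, decide (0 ≤ k))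

theorem abs_lt_of_dyadicBlock {k : ℤ} {j : ℕ} {s : Bool} (hk : dyadicBlock k = (j, s)) :
    |(k : ℝ)| < 2 * 2 ^ j := by
  have h1 : Nat.log 2 k.natAbs = j := congrArg Prod.fst hk
  have h2 := Nat.lt_pow_succ_log_self (b := 2) (by norm_num) k.natAbs
  rw [h1, pow_succ'] at h2
  rw [← Int.cast_abs, Int.abs_eq_natAbs]
  exact_mod_cast h2

theorem two_pow_le_of_dyadicBlock {k : ℤ} {j : ℕ} {s : Bool} (hk : dyadicBlock k = (j, s)) :
    (2 : ℝ) ^ j ≤ 1 + |(k : ℝ)| := by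
  have h1 : Nat.log 2 k.natAbs = j := congrArg Prod.fst hk
  have h2 : 2 ^ j ≤ 1 + k.natAbs := by
    rcases eq_or_ne k.natAbs 0 with h0 | h0
    · rw [← h1, h0]
      simp
    · have := Nat.pow_log_le_self 2 h0
      rw [h1] at this
      omega
  rw [← Int.cast_abs, Int.abs_eq_natAbs]
  exact_mod_cast h2

theorem two_pow_le_abs_of_dyadicBlock {k : ℤ} {j : ℕ} {s : Bool}
    (hk : dyadicBlock k = (j, s)) (hj : j ≠ 0) : (2 : ℝ) ^ j ≤ |(k : ℝ)| := by
  have h1 : Nat.log 2 k.natAbs = j := congrArg Prod.fst hk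
  have h0 : k.natAbs ≠ 0 := by
    intro h0
    rw [h0] at h1
    simp at h1
    exact hj h1.symm
  have h2 := Nat.pow_log_le_self 2 h0
  rw [h1] at h2
  rw [← Int.cast_abs, Int.abs_eq_natAbs]
  exact_mod_cast h2

theorem dyadic_six_bound {α : ℝ} (β : ℝ) (hα : α ≠ 0) {lam : ℝ} (hlam : 0 < lam) :
    ∃ C : ℝ, 0 ≤ C ∧ ∀ (m : ℝ) (F : ℤ → ℝ → ℂ) (e : ℤ → ℝ),
      WavePackets (fun k => phase α β k + m) F e → ∀ (j : ℕ) (s : Bool) (S : Finset ℤ),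
        (∀ k ∈ S, dyadicBlock k = (j, s)) →
          ∫ z, ‖modeSum F S z‖ ^ 6 ≤ C * ((2 : ℝ) ^ j) ^ lam * (∑ k ∈ S, e k) ^ 3 := by
  obtain ⟨C, hC, hG⟩ := growthExponent_of_pos (B := 18) (by norm_num) hlam
  have hα' : 0 < |α| := abs_pos.2 hα
  -- Below `j₀` the trivial bound suffices, with a constant depending only on `α` and `β`. The entry
  -- `1` in the maximum forces `j₀ ≥ 1`, which keeps the block `j = 0`, the one containing `k = 0`,
  -- out of the curved case.
  obtain ⟨j₀, hj₀⟩ := pow_unbounded_of_one_lt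
    (max 1 (max (3 * |β| / (5 * |α|)) (2 * Real.pi / (10 * |α|)))) (one_lt_two (α := ℝ))
  have hpi := Real.pi_pos
  set C₂ : ℝ := 8 * Real.pi * (2 * (4 * 2 ^ j₀) + 3) ^ 5
  have hC₂ : 0 ≤ C₂ := by positivity
  refine ⟨C + C₂, by positivity, fun m F e hF j s S hS => ?_⟩
  have hE := hF.sum_energy_nonneg S
  have hX : (1 : ℝ) ≤ 2 ^ j := one_le_pow₀ (by norm_num)
  have hXl : (1 : ℝ) ≤ (2 ^ j) ^ lam := Real.one_le_rpow hX hlam.le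
  rcases lt_or_ge j j₀ with hj | hj
  · have hdiam : DiamLE S (4 * 2 ^ j₀) := by
      intro k hk l hl
      have h1 := abs_lt_of_dyadicBlock (hS k hk)
      have h2 := abs_lt_of_dyadicBlock (hS l hl)
      have h3 : (2 : ℝ) ^ j ≤ 2 ^ j₀ := pow_le_pow_right₀ (by norm_num) hj.le
      have h4 := abs_sub (k : ℝ) l
      linarith
    have h5 := sixBound_trivial (fun x => phase α β x + m) Set.univ (by positivity) F e hF S
      (fun _ _ => Set.mem_univ _) hdiam
    refine h5.trans ?_
    refine mul_le_mul_of_nonneg_right ?_ (by positivity)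
    calc C₂ ≤ C + C₂ := by linarith
      _ ≤ _ := le_mul_of_one_le_right (by positivity) hXl
  · set X : ℝ := 2 ^ j
    have hXj : (2 : ℝ) ^ j₀ ≤ X := pow_le_pow_right₀ (by norm_num) hj
    obtain ⟨h1, h23⟩ := max_lt_iff.1 hj₀
    obtain ⟨h2, h3⟩ := max_lt_iff.1 h23
    have hj0 : j ≠ 0 := by
      rintro rfl
      have : j₀ = 0 := by omega
      rw [this] at h1
      norm_num at h1
    rw [div_lt_iff₀' (by positivity)] at h2 h3
    have hβ : 3 * |β| ≤ 5 * |α| * X ^ 2 := by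
      refine h2.le.trans ?_
      gcongr
      exact hXj.trans (le_self_pow₀ hX (by norm_num))
    have hα2 : 2 * Real.pi ≤ 10 * |α| * X ^ 3 := by
      refine h3.le.trans ?_
      gcongr
      exact hXj.trans (le_self_pow₀ hX (by norm_num))
    have habs : ∀ k ∈ S, X ≤ |(k : ℝ)| ∧ |(k : ℝ)| ≤ 2 * X := fun k hk =>
      ⟨two_pow_le_abs_of_dyadicBlock (hS k hk) hj0, (abs_lt_of_dyadicBlock (hS k hk)).le⟩
    have hfin : ∀ U : Set ℝ, CurvedPhase 18 (10 * |α| * X ^ 3 / (2 * Real.pi)) U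
        (fun x => phase α β x + m)
        (fun x => (-5 * α * x ^ 4 + 3 * β * x ^ 2) / (2 * Real.pi)) →
        (∀ k ∈ S, (k : ℝ) ∈ U) → (∀ x ∈ U, ∀ y ∈ U, |x - y| ≤ X) →
        ∫ z, ‖modeSum F S z‖ ^ 6 ≤ (C + C₂) * X ^ lam * (∑ k ∈ S, e k) ^ 3 := by
      intro U H hU hd
      refine (hG _ U _ _ H X hX F e hF S hU
        fun k hk l hl => hd _ (hU k hk) _ (hU l hl)).trans ?_
      gcongr
      linarith
    cases s with
    | true =>
      refine hfin (Set.Icc X (2 * X)) (curvedPhase_of_abs_bounds hX hβ hα2 Set.ordConnected_Icc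
        (fun x hx => ?_) fun x hx y hy => ?_) (fun k hk => ?_) fun x hx y hy => ?_
      · rwa [abs_of_nonneg (by linarith [hx.1])]
      · rw [abs_of_nonneg (by linarith [hx.1, hy.1]), abs_of_nonneg (by linarith [hx.1]),
          abs_of_nonneg (by linarith [hy.1])]
      · have h0 : 0 ≤ k := of_decide_eq_true (congrArg Prod.snd (hS k hk))
        have := habs k hk
        rwa [abs_of_nonneg (by exact_mod_cast h0)] at this
      · rw [abs_le]
        constructor <;> linarith [hx.1, hx.2, hy.1, hy.2]
    | false =>
      refine hfin (Set.Icc (-(2 * X)) (-X)) (curvedPhase_of_abs_bounds hX hβ hα2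
        Set.ordConnected_Icc (fun x hx => ?_) fun x hx y hy => ?_) (fun k hk => ?_)
        fun x hx y hy => ?_
      · rw [abs_of_nonpos (by linarith [hx.2])]
        constructor <;> linarith [hx.1, hx.2]
      · rw [abs_of_nonpos (by linarith [hx.2, hy.2]), abs_of_nonpos (by linarith [hx.2]),
          abs_of_nonpos (by linarith [hy.2])]
        ring
      · have h0 : ¬ 0 ≤ k := of_decide_eq_false (congrArg Prod.snd (hS k hk))
        have h1 : (k : ℝ) < 0 := by exact_mod_cast not_le.1 h0
        have := habs k hk
        rw [abs_of_neg h1] at this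
        constructor <;> linarith [this.1, this.2]
      · rw [abs_le]
        constructor <;> linarith [hx.1, hx.2, hy.1, hy.2]

theorem WavePackets.eLpNorm_six_le {ψ : ℤ → ℝ} {F : ℤ → ℝ → ℂ} {e : ℤ → ℝ}
    (h : WavePackets ψ F e) (S : Finset ℤ) {x : ℝ} (hx : 0 ≤ x)
    (hS : ∫ z, ‖modeSum F S z‖ ^ 6 ≤ x ^ 6) :
    eLpNorm (modeSum F S) 6 volume ≤ ENNReal.ofReal x := by
  have hmem : MemLp (modeSum F S) 6 volume := by
    have := (integrable_norm_rpow_iff (μ := volume) (p := 6) (h.continuous_modeSum S).aestronglyMeasurable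
      (by norm_num) (by norm_num)).1
    refine this ((h.integrable_pow S (a := 6) (by norm_num)).congr
      (Filter.Eventually.of_forall fun z => ?_))
    simp only [ENNReal.toReal_ofNat]
    exact (Real.rpow_natCast _ 6).symm
  rw [hmem.eLpNorm_eq_integral_rpow_norm (by norm_num) (by norm_num)]
  refine ENNReal.ofReal_le_ofReal ?_
  have h6 : ∀ y : ℝ, y ^ (6 : ℝ) = y ^ 6 := fun y => Real.rpow_natCast y 6
  simp only [ENNReal.toReal_ofNat, h6]
  rw [Real.rpow_inv_le_iff_of_pos (integral_nonneg fun _ => by positivity) hx (by norm_num), h6]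
  exact hS

/-- The `L⁶` bound with an `ε`-loss for functions with frequencies near a translate of the
characteristic curve. -/
theorem modeSum_eLpNorm_le {α : ℝ} (β : ℝ) (hα : α ≠ 0) {ε : ℝ} (hε : 0 < ε) :
    ∃ C : ℝ, 0 ≤ C ∧ ∀ (m : ℝ) (F : ℤ → ℝ → ℂ) (e : ℤ → ℝ),
      WavePackets (fun k => phase α β k + m) F e → ∀ S : Finset ℤ,
        eLpNorm (modeSum F S) 6 volume ≤
          ENNReal.ofReal (C * √(∑ k ∈ S, (1 + |(k : ℝ)|) ^ (2 * ε) * e k)) := by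
  -- After a sixth root the block at `2 ^ j` loses `2 ^ (j * ε / 2)`, while the weight supplies `2 ^
  -- (-j * ε)`; the surplus `r ^ j` is summable over blocks. The `2` in the final constant counts
  -- the two signs.
  obtain ⟨C, hC, hbound⟩ := dyadic_six_bound β hα (lam := 6 * (ε / 2)) (by positivity)
  set D : ℝ := C ^ (1 / 6 : ℝ)
  have hD : 0 ≤ D := by positivity
  have hD6 : D ^ 6 = C := by
    rw [← Real.rpow_natCast, ← Real.rpow_mul hC]
    norm_num
  set r : ℝ := (2 : ℝ) ^ (-(ε / 2))
  have hr0 : 0 < r := by positivity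
  have hr1 : r < 1 := Real.rpow_lt_one_of_one_lt_of_neg (by norm_num) (by linarith)
  have hr1' : 0 < 1 - r := by linarith
  refine ⟨D * (2 / (1 - r)), by positivity, fun m F e hF S => ?_⟩
  set A := ∑ k ∈ S, (1 + |(k : ℝ)|) ^ (2 * ε) * e k
  let G : ℕ × Bool → Finset ℤ := fun a => S.filter fun k => dyadicBlock k = a
  have hsplit : modeSum F S = ∑ a ∈ S.image dyadicBlock, modeSum F (G a) := by
    funext z
    rw [Finset.sum_apply]
    exact (Finset.sum_fiberwise_of_maps_to
      (fun _ hk => Finset.mem_image_of_mem dyadicBlock hk) _).symm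
  have hpiece : ∀ a, eLpNorm (modeSum F (G a)) 6 volume ≤
      ENNReal.ofReal (D * √A * r ^ a.1) := by
    rintro ⟨j, s⟩
    have hGb : ∀ k ∈ G (j, s), dyadicBlock k = (j, s) := fun k hk => (Finset.mem_filter.1 hk).2
    refine hF.eLpNorm_six_le _ (by positivity) ((hbound m F e hF j s _ hGb).trans ?_)
    set X : ℝ := 2 ^ j
    have hX0 : 0 < X := by positivity
    have hE := hF.sum_energy_nonneg (G (j, s))
    have h1 : X ^ (2 * ε) * ∑ k ∈ G (j, s), e k ≤ A := by
      rw [Finset.mul_sum]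
      refine (Finset.sum_le_sum fun k hk => ?_).trans
        (Finset.sum_le_sum_of_subset_of_nonneg (Finset.filter_subset _ _) fun k _ _ => ?_)
      · exact mul_le_mul_of_nonneg_right (Real.rpow_le_rpow hX0.le
          (two_pow_le_of_dyadicBlock (hGb k hk)) (by positivity)) (hF.energy_nonneg k)
      · have := hF.energy_nonneg k
        positivity
    have hA : 0 ≤ A := le_trans (by positivity) h1
    have hrj : r ^ j = X ^ (-(ε / 2)) := by
      simp only [r, X]
      rw [← Real.rpow_natCast, ← Real.rpow_natCast, ← Real.rpow_mul (by norm_num),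
        ← Real.rpow_mul (by norm_num), mul_comm]
    have h2 : X ^ ε * ∑ k ∈ G (j, s), e k ≤ (√A * r ^ j) ^ 2 := by
      rw [mul_pow, Real.sq_sqrt hA, hrj, ← Real.rpow_natCast, ← Real.rpow_mul hX0.le]
      calc X ^ ε * ∑ k ∈ G (j, s), e k
          = (X ^ (2 * ε) * ∑ k ∈ G (j, s), e k) * X ^ (-ε) := by
            rw [mul_right_comm, ← Real.rpow_add hX0]
            congr 2
            ring
        _ ≤ A * X ^ (-ε) := by gcongr
        _ = _ := by
            congr 2
            push_cast
            ring
    calc C * X ^ (6 * (ε / 2)) * (∑ k ∈ G (j, s), e k) ^ 3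
        = D ^ 6 * (X ^ ε * ∑ k ∈ G (j, s), e k) ^ 3 := by
          rw [hD6, mul_pow, mul_assoc, ← Real.rpow_natCast (X ^ ε), ← Real.rpow_mul hX0.le]
          congr 3
          push_cast
          ring
      _ ≤ D ^ 6 * ((√A * r ^ j) ^ 2) ^ 3 := by gcongr
      _ = _ := by ring
  rw [hsplit]
  refine (eLpNorm_sum_le (fun a _ => (hF.continuous_modeSum _).aestronglyMeasurable)
    (by norm_num)).trans ?_
  refine (Finset.sum_le_sum fun a _ => hpiece a).trans ?_
  rw [← ENNReal.ofReal_sum_of_nonneg fun a _ => by positivity]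
  refine ENNReal.ofReal_le_ofReal ?_
  rw [← Finset.mul_sum]
  have hgeom : ∑ a ∈ S.image dyadicBlock, r ^ a.1 ≤ 2 / (1 - r) := by
    have hsub : S.image dyadicBlock ⊆
        ((S.image dyadicBlock).image Prod.fst) ×ˢ (Finset.univ : Finset Bool) := by
      intro a ha
      exact Finset.mem_product.2 ⟨Finset.mem_image_of_mem _ ha, Finset.mem_univ _⟩
    refine (Finset.sum_le_sum_of_subset_of_nonneg hsub fun _ _ _ => by positivity).trans ?_
    rw [Finset.sum_product]
    simp only [Finset.sum_const, Finset.card_univ, Fintype.card_bool, nsmul_eq_mul]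
    rw [← Finset.mul_sum, div_eq_mul_inv, ← tsum_geometric_of_lt_one hr0.le hr1]
    push_cast
    gcongr
    exact (summable_geometric_of_lt_one hr0.le hr1).sum_le_tsum _ fun _ _ => by positivity
  calc D * √A * ∑ a ∈ S.image dyadicBlock, r ^ a.1 ≤ D * √A * (2 / (1 - r)) := by gcongr
    _ = _ := by ring

/-! ### Summation over the distance to the characteristic curve. -/

theorem summable_one_add_abs_rpow {s : ℝ} (hs : 1 < s) :
    Summable fun m : ℤ => (1 + |(m : ℝ)|) ^ (-s) := by
  refine Summable.of_norm_bounded_eventually (Real.summable_abs_int_rpow hs) ?_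
  have : {(0 : ℤ)}ᶜ ∈ (Filter.cofinite : Filter ℤ) := (Set.finite_singleton 0).compl_mem_cofinite
  filter_upwards [this] with m hm
  have hm' : 0 < |(m : ℝ)| := abs_pos.2 (by exact_mod_cast hm)
  rw [Real.norm_of_nonneg (by positivity)]
  exact Real.rpow_le_rpow_of_nonpos hm' (by linarith) (by linarith)

/-- The bound for one translate is uniform in `m`, so the triangle inequality and Cauchy–Schwarz
against `(1 + |m|) ^ (-b)` suffice; `b > 1/2` makes that sequence square summable. -/
theorem sum_modeSum_eLpNorm_le {α : ℝ} (β : ℝ) (hα : α ≠ 0) {ε b : ℝ} (hε : 0 < ε)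
    (hb : 1 / 2 < b) :
    ∃ C : ℝ, 0 ≤ C ∧ ∀ (F : ℤ → ℤ → ℝ → ℂ) (e : ℤ → ℤ → ℝ),
      (∀ m : ℤ, WavePackets (fun k => phase α β k + m) (F m) (e m)) → ∀ M S : Finset ℤ,
        eLpNorm (fun z => ∑ m ∈ M, modeSum (F m) S z) 6 volume ≤
          ENNReal.ofReal (C * √(∑ m ∈ M, (1 + |(m : ℝ)|) ^ (2 * b) *
            ∑ k ∈ S, (1 + |(k : ℝ)|) ^ (2 * ε) * e m k)) := by
  obtain ⟨C, hC, hbound⟩ := modeSum_eLpNorm_le β hα hε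
  have hsum := summable_one_add_abs_rpow (s := 2 * b) (by linarith)
  set Z := ∑' m : ℤ, (1 + |(m : ℝ)|) ^ (-(2 * b))
  refine ⟨C * √Z, by positivity, fun F e hF M S => ?_⟩
  set A : ℤ → ℝ := fun m => ∑ k ∈ S, (1 + |(k : ℝ)|) ^ (2 * ε) * e m k
  have hA : ∀ m, 0 ≤ A m := fun m => Finset.sum_nonneg fun k _ => by
    have := (hF m).energy_nonneg k
    positivity
  have heq : (fun z => ∑ m ∈ M, modeSum (F m) S z) = ∑ m ∈ M, modeSum (F m) S := by
    funext z
    rw [Finset.sum_apply]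
  rw [heq]
  refine (eLpNorm_sum_le (fun m _ => ((hF m).continuous_modeSum _).aestronglyMeasurable)
    (by norm_num)).trans ?_
  refine (Finset.sum_le_sum fun (m : ℤ) _ => hbound m (F m) (e m) (hF m) S).trans ?_
  rw [← ENNReal.ofReal_sum_of_nonneg fun m _ => by positivity, ← Finset.mul_sum, mul_assoc]
  refine ENNReal.ofReal_le_ofReal (mul_le_mul_of_nonneg_left ?_ hC)
  rw [← Real.sqrt_mul' _ (Finset.sum_nonneg fun m _ => mul_nonneg (by positivity) (hA m))]
  refine Real.le_sqrt_of_sq_le ?_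
  have hcs := Finset.sum_mul_sq_le_sq_mul_sq M (fun m => (1 + |(m : ℝ)|) ^ (-b))
    (fun m => (1 + |(m : ℝ)|) ^ b * √(A m))
  have e1 : ∀ m : ℤ, (1 + |(m : ℝ)|) ^ (-b) * ((1 + |(m : ℝ)|) ^ b * √(A m)) = √(A m) := by
    intro m
    rw [← mul_assoc, ← Real.rpow_add (by positivity)]
    simp
  have e2 : ∀ m : ℤ, ((1 + |(m : ℝ)|) ^ (-b)) ^ 2 = (1 + |(m : ℝ)|) ^ (-(2 * b)) := by
    intro m
    rw [← Real.rpow_natCast, ← Real.rpow_mul (by positivity)]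
    congr 1
    push_cast
    ring
  have e3 : ∀ m : ℤ, ((1 + |(m : ℝ)|) ^ b * √(A m)) ^ 2 = (1 + |(m : ℝ)|) ^ (2 * b) * A m := by
    intro m
    rw [mul_pow, Real.sq_sqrt (hA m), ← Real.rpow_natCast, ← Real.rpow_mul (by positivity)]
    congr 2
    push_cast
    ring
  simp only [e1, e2, e3] at hcs
  refine hcs.trans (mul_le_mul_of_nonneg_right ?_
    (Finset.sum_nonneg fun m _ => mul_nonneg (by positivity) (hA m)))
  exact hsum.sum_le_tsum _ fun _ _ => by positivity

/-- The part of `g` on `[c + m, c + m + 1)`. -/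
def blockPart (g : ℝ → ℂ) (c : ℝ) (m : ℤ) : ℝ → ℂ := {ξ : ℝ | ⌊ξ - c⌋ = m}.indicator g

theorem measurableSet_block (c : ℝ) (m : ℤ) : MeasurableSet {ξ : ℝ | ⌊ξ - c⌋ = m} :=
  (Int.measurable_floor.comp (measurable_id.sub_const c)) (measurableSet_singleton m)

theorem block_eq_Ico (c : ℝ) (m : ℤ) : {ξ : ℝ | ⌊ξ - c⌋ = m} = Set.Ico (c + m) (c + m + 1) := by
  ext ξ
  rw [Set.mem_ofPred_eq, Int.floor_eq_iff, Set.mem_Ico]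
  constructor <;> rintro ⟨h1, h2⟩ <;> constructor <;> linarith

theorem integral_sq_eq_of_eLpNorm_eq {f g : ℝ → ℂ} (hf : MemLp f 2 volume)
    (hg : MemLp g 2 volume) (h : eLpNorm f 2 volume = eLpNorm g 2 volume) :
    ∫ t, ‖f t‖ ^ 2 = ∫ t, ‖g t‖ ^ 2 := by
  rw [hf.eLpNorm_eq_integral_rpow_norm (by norm_num) (by norm_num),
    hg.eLpNorm_eq_integral_rpow_norm (by norm_num) (by norm_num),
    ENNReal.ofReal_eq_ofReal_iff (by positivity) (by positivity)] at h
  simp only [ENNReal.toReal_ofNat, Real.rpow_two] at h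
  exact (Real.rpow_left_inj (integral_nonneg fun _ => by positivity)
    (integral_nonneg fun _ => by positivity) (by norm_num)).1 h

theorem memLp_fourierInv {h : ℝ → ℂ} (h1 : Integrable h) (h2 : MemLp h 2 volume) :
    MemLp (𝓕⁻ h) 2 volume :=
  (memLp_congr_ae (fourierInv_toLp_ae_eq h1 h2)).1 (Lp.memLp _)

/-- Plancherel's theorem on `L¹ ∩ L²`. -/
theorem integral_sq_fourierInv {h : ℝ → ℂ} (h1 : Integrable h) (h2 : MemLp h 2 volume) :
    ∫ t, ‖(𝓕⁻ h) t‖ ^ 2 = ∫ ξ, ‖h ξ‖ ^ 2 := by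
  refine integral_sq_eq_of_eLpNorm_eq (memLp_fourierInv h1 h2) h2 ?_
  rw [← eLpNorm_congr_ae (fourierInv_toLp_ae_eq h1 h2)]
  have e1 : ‖(𝓕⁻ (h2.toLp h) : Lp ℂ 2 (volume : Measure ℝ))‖ = ‖h2.toLp h‖ :=
    (Lp.fourierTransformₗᵢ ℝ ℂ).symm.norm_map _
  rw [Lp.norm_def, Lp.norm_toLp] at e1
  exact (ENNReal.toReal_eq_toReal_iff' (Lp.eLpNorm_ne_top _) h2.2.ne).1 e1

/-- Cauchy–Schwarz on a block of length `1`. -/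
theorem sq_norm_fourierInv_blockPart_le {g : ℝ → ℂ} (h2 : MemLp g 2 volume) (c : ℝ) (m : ℤ)
    (t : ℝ) : ‖(𝓕⁻ (blockPart g c m)) t‖ ^ 2 ≤ ∫ ξ, ‖blockPart g c m ξ‖ ^ 2 := by
  set s : Set ℝ := {ξ : ℝ | ⌊ξ - c⌋ = m}
  have hs : MeasurableSet s := measurableSet_block c m
  have hvol : volume s = 1 := by
    simp only [s]
    rw [block_eq_Ico, Real.volume_Ico]
    simp
  have hmem : MemLp (s.indicator fun _ => (1 : ℝ)) 2 volume :=
    memLp_indicator_const 2 hs 1 (Or.inr (by rw [hvol]; norm_num))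
  have hmem' : MemLp (blockPart g c m) 2 volume := h2.indicator hs
  have h0 := sq_integral_mul_le (μ := volume) (a := s.indicator fun _ => (1 : ℝ))
    (b := fun ξ => ‖blockPart g c m ξ‖)
    (fun ξ => Set.indicator_nonneg (fun _ _ => zero_le_one) ξ) (fun ξ => norm_nonneg _)
    hmem hmem'.norm
  have e1 : ∀ ξ, s.indicator (fun _ => (1 : ℝ)) ξ * ‖blockPart g c m ξ‖ =
      ‖blockPart g c m ξ‖ := by
    intro ξ
    by_cases hξ : ξ ∈ s
    · rw [Set.indicator_of_mem hξ, one_mul]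
    · rw [blockPart, Set.indicator_of_notMem hξ, Set.indicator_of_notMem hξ]
      simp
  have e2 : ∫ ξ, s.indicator (fun _ => (1 : ℝ)) ξ ^ 2 = 1 := by
    have : (fun ξ => s.indicator (fun _ => (1 : ℝ)) ξ ^ 2) = s.indicator fun _ => (1 : ℝ) := by
      funext ξ
      by_cases hξ : ξ ∈ s <;> simp [hξ]
    rw [this, integral_indicator hs]
    simp [Measure.real, hvol]
  simp only [e1, e2, one_mul] at h0
  exact (pow_le_pow_left₀ (norm_nonneg _) (norm_fourierInv_le _ t) 2).trans h0

theorem wavePackets_blockPart {ψ : ℤ → ℝ} {g : ℤ → ℝ → ℂ} (h1 : ∀ k, Integrable (g k))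
    (h2 : ∀ k, MemLp (g k) 2 volume) (m : ℤ) :
    WavePackets (fun k => ψ k + m) (fun k => 𝓕⁻ (blockPart (g k) (ψ k) m))
      (fun k => ∫ ξ, ‖blockPart (g k) (ψ k) m ξ‖ ^ 2) := by
  have hi : ∀ k, Integrable (blockPart (g k) (ψ k) m) := fun k =>
    (h1 k).indicator (measurableSet_block _ m)
  have hm : ∀ k, MemLp (blockPart (g k) (ψ k) m) 2 volume := fun k =>
    (h2 k).indicator (measurableSet_block _ m)
  refine ⟨fun k => ⟨_, hi k, fun ξ hξ => ?_, rfl⟩, fun k => memLp_fourierInv (hi k) (hm k),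
    fun k t => ?_, fun k => (integral_sq_fourierInv (hi k) (hm k)).le⟩
  · refine Set.indicator_of_notMem (fun hmem => ?_) _
    rw [block_eq_Ico, Set.mem_Ico] at hmem
    have : |ξ - (ψ k + m)| ≤ 1 := abs_le.2 ⟨by linarith [hmem.1], by linarith [hmem.2]⟩
    linarith
  · have h0 : 0 ≤ ∫ ξ, ‖blockPart (g k) (ψ k) m ξ‖ ^ 2 := integral_nonneg fun _ => by positivity
    linarith [sq_norm_fourierInv_blockPart_le (h2 k) (ψ k) m t]

theorem hasSum_fourierInv_blockPart {g : ℝ → ℂ} (h1 : Integrable g) (c t : ℝ) :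
    HasSum (fun m => (𝓕⁻ (blockPart g c m)) t) ((𝓕⁻ g) t) := by
  have hint : Integrable fun ξ => Real.fourierChar (inner ℝ ξ t) • g ξ := by
    have := (Real.fourierIntegral_convergent_iff (f := g) (-t)).2 h1
    simpa using this
  have h := hasSum_integral_iUnion (μ := volume) (fun m : ℤ => measurableSet_block c m)
    (fun m n hmn => Set.disjoint_left.2 fun ξ (hm : _ = m) (hn : _ = n) => hmn (hm.symm.trans hn))
    hint.integrableOn
  have hU : ⋃ m : ℤ, {ξ : ℝ | ⌊ξ - c⌋ = m} = Set.univ :=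
    Set.eq_univ_of_forall fun ξ => Set.mem_iUnion.2 ⟨_, rfl⟩
  rw [hU, setIntegral_univ, ← Real.fourierInv_eq] at h
  have hpart : (fun m => (𝓕⁻ (blockPart g c m)) t) = fun m : ℤ =>
      ∫ ξ in {ξ : ℝ | ⌊ξ - c⌋ = m}, Real.fourierChar (inner ℝ ξ t) • g ξ := by
    funext m
    rw [Real.fourierInv_eq, ← integral_indicator (measurableSet_block c m), blockPart,
      ← Set.indicator_smul]
  rw [hpart]
  exact h

/-- The blocks are disjoint, and on block `m` one has `1 + |m| ≤ 2 * (1 + |ξ - c|)`, whence the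
factor `2 ^ (2 * b)`. -/
theorem sum_blockPart_energy_le {g : ℝ → ℂ} {c b : ℝ} (hb : 0 ≤ b) (h2 : MemLp g 2 volume)
    (hg : Integrable fun ξ => ((1 + |ξ - c|) ^ b * ‖g ξ‖) ^ 2) (M : Finset ℤ) :
    ∑ m ∈ M, (1 + |(m : ℝ)|) ^ (2 * b) * ∫ ξ, ‖blockPart g c m ξ‖ ^ 2 ≤
      2 ^ (2 * b) * ∫ ξ, ((1 + |ξ - c|) ^ b * ‖g ξ‖) ^ 2 := by
  have hi : ∀ m, Integrable fun ξ => ‖blockPart g c m ξ‖ ^ 2 := fun m => by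
    have hm : MemLp (blockPart g c m) 2 volume := h2.indicator (measurableSet_block _ m)
    exact (memLp_two_iff_integrable_sq_norm hm.1).1 hm
  simp_rw [← integral_const_mul]
  rw [← integral_finsetSum M fun m _ => (hi m).const_mul _]
  refine integral_mono (integrable_finsetSum M fun m _ => (hi m).const_mul _)
    (hg.const_mul _) fun ξ => ?_
  have e1 : ∀ m : ℤ, (1 + |(m : ℝ)|) ^ (2 * b) * ‖blockPart g c m ξ‖ ^ 2 =
      if ⌊ξ - c⌋ = m then (1 + |(m : ℝ)|) ^ (2 * b) * ‖g ξ‖ ^ 2 else 0 := by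
    intro m
    rw [blockPart, Set.indicator_apply]
    simp only [Set.mem_ofPred_eq]
    split_ifs <;> simp
  simp only [e1]
  rw [Finset.sum_ite_eq]
  have h3 : (1 + |(⌊ξ - c⌋ : ℝ)|) ^ (2 * b) ≤ 2 ^ (2 * b) * (1 + |ξ - c|) ^ (2 * b) := by
    rw [← Real.mul_rpow (by norm_num) (by positivity)]
    refine Real.rpow_le_rpow (by positivity) ?_ (by positivity)
    have h4 : |(⌊ξ - c⌋ : ℝ)| ≤ |ξ - c| + 1 := by
      have a1 := Int.floor_le (ξ - c)
      have a2 := Int.lt_floor_add_one (ξ - c)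
      have a3 := le_abs_self (ξ - c)
      have a4 := neg_abs_le (ξ - c)
      rw [abs_le]
      constructor <;> linarith
    linarith [abs_nonneg (ξ - c)]
  have h5 : ((1 + |ξ - c|) ^ b * ‖g ξ‖) ^ 2 = (1 + |ξ - c|) ^ (2 * b) * ‖g ξ‖ ^ 2 := by
    rw [mul_pow, ← Real.rpow_natCast ((1 + |ξ - c|) ^ b), ← Real.rpow_mul (by positivity)]
    congr 2
    push_cast
    ring
  rw [h5, ← mul_assoc]
  split_ifs
  · gcongr
  · positivity

/-- An `L²` function with a weight `(1 + |ξ - c|) ^ b`, `b > 1 / 2`, is integrable. -/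
theorem integrable_of_weighted_sq {g : ℝ → ℂ} {c b : ℝ} (hb : 1 / 2 < b)
    (hgm : AEStronglyMeasurable g volume)
    (hg : Integrable fun ξ => ((1 + |ξ - c|) ^ b * ‖g ξ‖) ^ 2) : Integrable g := by
  have hw : ∀ s : ℝ, Continuous fun ξ : ℝ => (1 + |ξ - c|) ^ s := fun s =>
    (by fun_prop : Continuous fun ξ : ℝ => 1 + |ξ - c|).rpow_const fun ξ => Or.inl (by positivity)
  have h1 : MemLp (fun ξ => (1 + |ξ - c|) ^ b * ‖g ξ‖) 2 volume :=
    (memLp_two_iff_integrable_sq ((hw b).aestronglyMeasurable.mul hgm.norm)).2 hg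
  have h2 : MemLp (fun ξ : ℝ => (1 + |ξ - c|) ^ (-b)) 2 volume := by
    refine (memLp_two_iff_integrable_sq (hw (-b)).aestronglyMeasurable).2 ?_
    have h3 := integrable_one_add_norm (E := ℝ) (μ := volume) (r := 2 * b)
      (by simp; linarith)
    refine (h3.comp_sub_right c).congr (Filter.Eventually.of_forall fun ξ => ?_)
    simp only [Real.norm_eq_abs]
    rw [← Real.rpow_natCast, ← Real.rpow_mul (by positivity)]
    congr 1
    push_cast
    ring
  have h4 := h2.integrable_mul h1
  refine (integrable_norm_iff hgm).1 (h4.congr (Filter.Eventually.of_forall fun ξ => ?_))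
  simp only [Pi.mul_apply]
  rw [← mul_assoc, ← Real.rpow_add (by positivity)]
  simp

/-! ### Fatou's lemma and partial Fourier sums. -/

/-- Fatou's lemma along a sequence of which every subsequence has a subsequence converging almost
everywhere. -/
theorem lintegral_rpow_enorm_le_liminf {X : Type*} [MeasurableSpace X] {μ : Measure X}
    {g : ℕ → X → ℂ} {w : X → ℂ} (hg : ∀ n, Measurable (g n))
    (h : ∀ ns : ℕ → ℕ, StrictMono ns → ∃ ms : ℕ → ℕ, ∀ᵐ x ∂μ,
      Filter.Tendsto (fun n => g (ns (ms n)) x) Filter.atTop (nhds (w x))) :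
    ∫⁻ x, ‖w x‖ₑ ^ (6 : ℝ) ∂μ ≤
      Filter.liminf (fun n => ∫⁻ x, ‖g n x‖ₑ ^ (6 : ℝ) ∂μ) Filter.atTop := by
  refine le_of_forall_gt fun c hc => ?_
  obtain ⟨c', hc', hcc⟩ := exists_between hc
  -- The subsequence with small integrals comes first; almost everywhere convergence is then
  -- extracted inside it, so the limit sees only integrals below `c'`.
  obtain ⟨ns, hns, hlt⟩ := Filter.extraction_of_frequently_atTop
    (Filter.frequently_lt_of_liminf_lt (by isBoundedDefault) hc')
  obtain ⟨ms, hms⟩ := h ns hns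
  refine lt_of_le_of_lt ?_ hcc
  calc ∫⁻ x, ‖w x‖ₑ ^ (6 : ℝ) ∂μ
      = ∫⁻ x, Filter.liminf (fun n => ‖g (ns (ms n)) x‖ₑ ^ (6 : ℝ)) Filter.atTop ∂μ := by
        refine lintegral_congr_ae ?_
        filter_upwards [hms] with x hx
        exact ((ENNReal.continuous_rpow_const.tendsto _).comp hx.enorm).liminf_eq.symm
    _ ≤ Filter.liminf (fun n => ∫⁻ x, ‖g (ns (ms n)) x‖ₑ ^ (6 : ℝ) ∂μ) Filter.atTop :=
        lintegral_liminf_le fun n => (hg _).enorm.pow_const _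
    _ ≤ c' := Filter.liminf_le_of_frequently_le'
        (Filter.Frequently.of_forall fun n => (hlt (ms n)).le)

/-- On a circle, a subsequence of the partial Fourier sums of a square integrable function
converges almost everywhere. -/
theorem exists_subseq_fourier_tendsto {w : Torus → ℂ} (hw : MemLp w 2 volume)
    {S : ℕ → Finset ℤ} (hS : Filter.Tendsto S Filter.atTop Filter.atTop) :
    ∃ ms : ℕ → ℕ, ∀ᵐ x : Torus, Filter.Tendsto
      (fun n => ∑ k ∈ S (ms n), fourier k x * fourierCoeff w k) Filter.atTop (nhds (w x)) := by
  have hw' : MemLp w 2 AddCircle.haarAddCircle := memLp_haarAddCircle_iff.2 hw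
  have hsum := (hasSum_fourier_series_L2 (hw'.toLp w)).comp hS
  obtain ⟨ms, -, hms⟩ := (tendstoInMeasure_of_tendsto_Lp hsum).exists_seq_tendsto_ae
  refine ⟨ms, ?_⟩
  have hae : ∀ᵐ x ∂(AddCircle.haarAddCircle (T := 2 * Real.pi)), Filter.Tendsto
      (fun n => ∑ k ∈ S (ms n), fourier k x * fourierCoeff w k) Filter.atTop (nhds (w x)) := by
    have h1 : ∀ n, ((∑ k ∈ S n, fourierCoeff (hw'.toLp w) k • fourierLp 2 k :
        Lp ℂ 2 (AddCircle.haarAddCircle (T := 2 * Real.pi))) : Torus → ℂ)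
        =ᵐ[AddCircle.haarAddCircle] fun x => ∑ k ∈ S n, fourier k x * fourierCoeff w k := by
      intro n
      have h2 : ∀ k : ℤ, ∀ᵐ x ∂(AddCircle.haarAddCircle (T := 2 * Real.pi)),
          (fourierCoeff (hw'.toLp w) k • fourierLp 2 k :
            Lp ℂ 2 (AddCircle.haarAddCircle (T := 2 * Real.pi))) x =
          fourier k x * fourierCoeff w k := by
        intro k
        filter_upwards [Lp.coeFn_smul (fourierCoeff (hw'.toLp w) k)
          (fourierLp (T := 2 * Real.pi) 2 k), coeFn_fourierLp (T := 2 * Real.pi) 2 k]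
          with x hx hx'
        rw [hx, Pi.smul_apply, hx', fourierCoeff_congr_ae hw'.coeFn_toLp, smul_eq_mul, mul_comm]
      filter_upwards [Lp.coeFn_finsetSum (S n) fun k =>
        (fourierCoeff (hw'.toLp w) k • fourierLp 2 k :
          Lp ℂ 2 (AddCircle.haarAddCircle (T := 2 * Real.pi))), ae_all_iff.2 h2] with x hx hx'
      rw [hx, Finset.sum_apply]
      exact Finset.sum_congr rfl fun k _ => hx' k
    filter_upwards [hms, ae_all_iff.2 h1, hw'.coeFn_toLp] with x hx hx1 hx2
    rw [hx2] at hx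
    exact hx.congr fun n => hx1 (ms n)
  rw [AddCircle.volume_eq_smul_haarAddCircle]
  exact Measure.ae_smul_measure hae _

theorem ae_memLp_slice {v : Torus × ℝ → ℂ} (hv : MemLp v 2 volume) :
    ∀ᵐ t : ℝ, MemLp (fun x : Torus => v (x, t)) 2 volume := by
  have hfin := (eLpNorm_lt_top_iff_lintegral_rpow_enorm_lt_top (by norm_num) (by norm_num)).1 hv.2
  have hm : AEMeasurable (fun z => ‖v z‖ₑ ^ (2 : ℝ≥0∞).toReal)
      ((volume : Measure Torus).prod (volume : Measure ℝ)) := hv.1.enorm.pow_const _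
  rw [Measure.volume_eq_prod, lintegral_prod_symm _ hm] at hfin
  filter_upwards [ae_lt_top' hm.prod_swap.lintegral_prod_right' hfin.ne,
    (show AEStronglyMeasurable v (volume.prod volume) from hv.1).prodMk_right] with t ht htm
  exact ⟨htm, (eLpNorm_lt_top_iff_lintegral_rpow_enorm_lt_top (by norm_num) (by norm_num)).2 ht⟩

/-- The `L⁶` norm of a square integrable function is controlled by those of its partial Fourier
sums in space. -/
theorem eLpNorm_six_le_of_modeSum {v : Torus × ℝ → ℂ} (hv : MemLp v 2 volume)
    {G : ℤ → ℝ → ℂ} (hGc : ∀ k, Continuous (G k)) (hG : ∀ k, G k =ᵐ[volume] spaceCoeff v k)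
    {X : ℝ≥0∞} (hX : ∀ S : Finset ℤ, eLpNorm (modeSum G S) 6 volume ≤ X) :
    eLpNorm v 6 volume ≤ X := by
  obtain ⟨S, hS⟩ := Filter.exists_seq_tendsto (Filter.atTop : Filter (Finset ℤ))
  have hnorm : ∀ f : Torus × ℝ → ℂ,
      eLpNorm f 6 volume = (∫⁻ z, ‖f z‖ₑ ^ (6 : ℝ)) ^ (1 / 6 : ℝ) := fun f => by
    rw [eLpNorm_eq_lintegral_rpow_enorm_toReal (by norm_num) (by norm_num), ENNReal.toReal_ofNat]
  have hc : ∀ n, Continuous (modeSum G (S n)) := fun n =>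
    continuous_finsetSum _ fun k _ =>
      ((fourier k).continuous.comp continuous_fst).mul ((hGc k).comp continuous_snd)
  have hm : ∀ f : Torus × ℝ → ℂ, AEStronglyMeasurable f volume →
      AEMeasurable (fun z => ‖f z‖ₑ ^ (6 : ℝ)) ((volume : Measure Torus).prod volume) :=
    fun f hf => hf.enorm.pow_const _
  -- The convergent subsequence depends on `t`, so Fatou is applied in `x` for each `t` to the full
  -- sequence, and only afterwards in `t`.
  have hslice : ∀ᵐ t : ℝ, ∫⁻ x : Torus, ‖v (x, t)‖ₑ ^ (6 : ℝ) ≤ Filter.liminf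
      (fun n => ∫⁻ x : Torus, ‖modeSum G (S n) (x, t)‖ₑ ^ (6 : ℝ)) Filter.atTop := by
    filter_upwards [ae_memLp_slice hv, ae_all_iff.2 hG] with t ht hGt
    refine lintegral_rpow_enorm_le_liminf
      (fun n => ((hc n).comp (by fun_prop : Continuous fun x : Torus => (x, t))).measurable)
      fun ns hns => ?_
    obtain ⟨ms, hms⟩ := exists_subseq_fourier_tendsto ht (hS.comp hns.tendsto_atTop)
    refine ⟨ms, ?_⟩
    filter_upwards [hms] with x hx
    refine hx.congr fun n => ?_
    simp only [modeSum, Function.comp_apply]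
    exact Finset.sum_congr rfl fun k _ => by rw [hGt k]; rfl
  have key : ∫⁻ z, ‖v z‖ₑ ^ (6 : ℝ) ≤ X ^ (6 : ℝ) := by
    rw [Measure.volume_eq_prod, lintegral_prod_symm _ (hm v hv.1)]
    refine (lintegral_mono_ae hslice).trans ((lintegral_liminf_le fun n =>
      ((hc n).enorm.measurable.pow_const _).lintegral_prod_left').trans
      (Filter.liminf_le_of_frequently_le' (Filter.Frequently.of_forall fun n => ?_)))
    rw [← lintegral_prod_symm _ (hm _ (hc n).aestronglyMeasurable), ← Measure.volume_eq_prod]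
    have h1 := ENNReal.rpow_le_rpow (hX (S n)) (by norm_num : (0 : ℝ) ≤ 6)
    rw [hnorm, ← ENNReal.rpow_mul] at h1
    simpa using h1
  rw [hnorm]
  refine (ENNReal.rpow_le_rpow key (by norm_num)).trans ?_
  rw [← ENNReal.rpow_mul]
  simp

/-! ### The Strichartz estimate in the Bourgain norm. -/

/-- The Fourier transform of the `k`-th space coefficient, in the variable of `e^{2πiξt}`. -/
def coeffTransform {v : Torus × ℝ → ℂ} (hv : MemLp v 2 volume) (k : ℤ) :
    Lp ℂ 2 (volume : Measure ℝ) :=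
  𝓕 ((memLp_spaceCoeff hv k).toLp (spaceCoeff v k))

theorem spaceCoeff_ae_eq {v : Torus × ℝ → ℂ} (hv : MemLp v 2 volume) (k : ℤ)
    (hi : Integrable (coeffTransform hv k : ℝ → ℂ)) :
    𝓕⁻ (coeffTransform hv k : ℝ → ℂ) =ᵐ[volume] spaceCoeff v k := by
  have h1 := fourierInv_toLp_ae_eq hi (Lp.memLp _)
  rw [Lp.toLp_coeFn] at h1
  have h2 : (𝓕⁻ (coeffTransform hv k) : Lp ℂ 2 (volume : Measure ℝ)) =
      (memLp_spaceCoeff hv k).toLp (spaceCoeff v k) :=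
    FourierPair.fourierInv_fourier_eq _
  rw [h2] at h1
  exact h1.symm.trans (memLp_spaceCoeff hv k).coeFn_toLp

/-- Change of variables `τ = 2πξ`. The normalisation `1/2π` of the transform costs `(2π)²`, the
Jacobian returns one factor `2π`, and the weight in `ξ` is the smaller one because `2π ≥ 1`. -/
theorem weighted_lintegral_le {v : Torus × ℝ → ℂ} (hv : MemLp v 2 volume) (α β s : ℝ) {b : ℝ}
    (hb : 0 ≤ b) (k : ℤ) :
    ∫⁻ ξ, ENNReal.ofReal ((1 + |(k : ℝ)|) ^ (2 * s) *
        ((1 + |ξ - phase α β k|) ^ b * ‖coeffTransform hv k ξ‖) ^ 2) ≤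
      ENNReal.ofReal (2 * Real.pi) * ∫⁻ τ : ℝ, ENNReal.ofReal (bracket k ^ s *
        bracket (τ + α * (k : ℝ) ^ 5 - β * (k : ℝ) ^ 3) ^ b *
          ‖spaceTimeFourier v hv k τ‖) ^ 2 := by
  have hpi := Real.two_pi_pos
  have hpi1 : 1 ≤ 2 * Real.pi := by linarith [Real.pi_gt_three]
  set H : ℝ → ℝ≥0∞ := fun ξ => ENNReal.ofReal ((1 + |(k : ℝ)|) ^ (2 * s) *
        ((1 + |ξ - phase α β k|) ^ b * ‖coeffTransform hv k ξ‖) ^ 2)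
  have hHm : Measurable H := by
    have h1 : Measurable fun ξ => ‖coeffTransform hv k ξ‖ :=
      (Lp.stronglyMeasurable (coeffTransform hv k)).measurable.norm
    have h2 : Measurable fun ξ : ℝ => (1 + |ξ - phase α β k|) ^ b := by fun_prop
    exact (((h2.mul h1).pow_const 2).const_mul _).ennreal_ofReal
  have hchange : ∫⁻ τ, H ((2 * Real.pi)⁻¹ * τ) = ENNReal.ofReal (2 * Real.pi) * ∫⁻ ξ, H ξ := by
    rw [← lintegral_map hHm (measurable_const_mul _),
      Real.map_volume_mul_left (inv_ne_zero hpi.ne'), lintegral_smul_measure, inv_inv,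
      abs_of_pos hpi, smul_eq_mul]
  have hpt : ∀ τ, H ((2 * Real.pi)⁻¹ * τ) ≤ ENNReal.ofReal ((2 * Real.pi) ^ 2) *
      ENNReal.ofReal (bracket k ^ s * bracket (τ + α * (k : ℝ) ^ 5 - β * (k : ℝ) ^ 3) ^ b *
          ‖spaceTimeFourier v hv k τ‖) ^ 2 := by
    intro τ
    have hbr : ∀ x, 0 ≤ bracket x := fun x => by unfold bracket; positivity
    have hnn : 0 ≤ bracket k ^ s * bracket (τ + α * (k : ℝ) ^ 5 - β * (k : ℝ) ^ 3) ^ b *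
          ‖spaceTimeFourier v hv k τ‖ :=
      mul_nonneg (mul_nonneg (Real.rpow_nonneg (hbr _) _) (Real.rpow_nonneg (hbr _) _))
        (norm_nonneg _)
    rw [← ENNReal.ofReal_pow hnn, ← ENNReal.ofReal_mul (by positivity)]
    refine ENNReal.ofReal_le_ofReal ?_
    have e1 : ‖spaceTimeFourier v hv k τ‖ =
        (2 * Real.pi)⁻¹ * ‖coeffTransform hv k ((2 * Real.pi)⁻¹ * τ)‖ := by
      rw [spaceTimeFourier, timeFourier, norm_mul, inv_mul_eq_div (2 * Real.pi) τ]
      congr 1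
      rw [norm_div, norm_one, one_div, norm_mul, Complex.norm_real, Complex.norm_ofNat,
        Real.norm_of_nonneg Real.pi_pos.le]
    have e2 : 1 + |(2 * Real.pi)⁻¹ * τ - phase α β k| ≤
        bracket (τ + α * (k : ℝ) ^ 5 - β * (k : ℝ) ^ 3) := by
      have e3 : (2 * Real.pi)⁻¹ * τ - phase α β k =
          (2 * Real.pi)⁻¹ * (τ + α * (k : ℝ) ^ 5 - β * (k : ℝ) ^ 3) := by
        rw [phase]
        field_simp
        ring
      rw [e3, abs_mul, abs_of_pos (by positivity : 0 < (2 * Real.pi)⁻¹), bracket]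
      have := mul_le_of_le_one_left (abs_nonneg (τ + α * (k : ℝ) ^ 5 - β * (k : ℝ) ^ 3))
        (inv_le_one_of_one_le₀ hpi1)
      linarith
    have e4 : (1 + |(k : ℝ)|) ^ (2 * s) = (bracket k ^ s) ^ 2 := by
      rw [bracket, ← Real.rpow_natCast, ← Real.rpow_mul (by positivity)]
      congr 1
      push_cast
      ring
    rw [e1, e4]
    set N := ‖coeffTransform hv k ((2 * Real.pi)⁻¹ * τ)‖
    have hN : 0 ≤ N := norm_nonneg _
    calc (bracket k ^ s) ^ 2 * ((1 + |(2 * Real.pi)⁻¹ * τ - phase α β k|) ^ b * N) ^ 2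
        ≤ (bracket k ^ s) ^ 2 *
          (bracket (τ + α * (k : ℝ) ^ 5 - β * (k : ℝ) ^ 3) ^ b * N) ^ 2 := by gcongr
      _ = _ := by field_simp
  have hle := lintegral_mono (μ := volume) hpt
  rw [hchange, lintegral_const_mul' _ _ ENNReal.ofReal_ne_top, sq (2 * Real.pi),
    ENNReal.ofReal_mul hpi.le, mul_assoc] at hle
  exact (ENNReal.mul_le_mul_iff_right (ENNReal.ofReal_pos.2 hpi).ne' ENNReal.ofReal_ne_top).1 hle

/-- The `L⁶` Strichartz estimate, global in time. -/
theorem eLpNorm_six_le_bourgainNorm (α β : ℝ) (hα : α ≠ 0) {ε : ℝ} (hε : 0 < ε) {b : ℝ}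
    (hb : 1 / 2 < b) : ∃ C : ℝ, 0 ≤ C ∧ ∀ v : Torus × ℝ → ℂ, MemLp v 2 volume →
      bourgainNorm α β ε b v ≠ ∞ →
        eLpNorm v 6 volume ≤ ENNReal.ofReal C * bourgainNorm α β ε b v := by
  obtain ⟨C, hC, hbound⟩ := sum_modeSum_eLpNorm_le β hα hε hb
  have hpi := Real.two_pi_pos
  refine ⟨C * √(2 ^ (2 * b) * (2 * Real.pi)), by positivity, fun v hv hA => ?_⟩
  set A := bourgainNorm α β ε b v
  set T : ℤ → ℝ≥0∞ := fun k => ∫⁻ τ : ℝ, ENNReal.ofReal (bracket k ^ ε *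
    bracket (τ + α * (k : ℝ) ^ 5 - β * (k : ℝ) ^ 3) ^ b * ‖spaceTimeFourier v hv k τ‖) ^ 2
  have hAT : ∑' k, T k = A ^ 2 := by
    have : A = (∑' k, T k) ^ (1 / 2 : ℝ) := by
      simp only [A, bourgainNorm, dif_pos hv]
      rfl
    rw [this, ← ENNReal.rpow_natCast, ← ENNReal.rpow_mul]
    norm_num
  have hTS : ∀ S : Finset ℤ, ∑ k ∈ S, T k ≤ A ^ 2 := fun S => hAT ▸ ENNReal.sum_le_tsum S
  have hTk : ∀ k, T k ≠ ∞ := fun k =>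
    ne_top_of_le_ne_top (ENNReal.pow_ne_top hA) (by simpa using hTS {k})
  let g : ℤ → ℝ → ℂ := fun k => coeffTransform hv k
  let c : ℤ → ℝ := fun k => (1 + |(k : ℝ)|) ^ (2 * ε)
  let w : ℤ → ℝ → ℝ := fun k ξ => ((1 + |ξ - phase α β k|) ^ b * ‖g k ξ‖) ^ 2
  have hc : ∀ k, 0 < c k := fun k => by positivity
  have hle : ∀ k, ∫⁻ ξ, ENNReal.ofReal (c k * w k ξ) ≤ ENNReal.ofReal (2 * Real.pi) * T k :=
    fun k => weighted_lintegral_le hv α β ε (by linarith) k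
  have hgm : ∀ k, AEStronglyMeasurable (g k) volume := fun k => (Lp.memLp _).1
  have hw : ∀ k, Integrable (w k) := by
    intro k
    have hcont : Continuous fun ξ : ℝ => (1 + |ξ - phase α β k|) ^ b :=
      (by fun_prop : Continuous fun ξ : ℝ => 1 + |ξ - phase α β k|).rpow_const
        fun ξ => Or.inl (by positivity)
    have h1 : AEStronglyMeasurable (w k) volume :=
      (hcont.aestronglyMeasurable.mul (hgm k).norm).pow 2
    have h2 : Integrable fun ξ => c k * w k ξ := by
      refine ⟨h1.const_mul _, (hasFiniteIntegral_iff_ofReal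
        (Filter.Eventually.of_forall fun ξ => by positivity)).2 ?_⟩
      exact (hle k).trans_lt (ENNReal.mul_lt_top ENNReal.ofReal_lt_top (hTk k).lt_top)
    exact (integrable_const_mul_iff (hc k).ne'.isUnit _).1 h2
  -- Integrability makes the inverse transform of `g k` a continuous representative of the space
  -- coefficient, given pointwise by the sum of its blocks.
  have hgi : ∀ k, Integrable (g k) := fun k => integrable_of_weighted_sq hb (hgm k) (hw k)
  have hg2 : ∀ k, MemLp (g k) 2 volume := fun k => Lp.memLp _
  have henergy : ∀ S : Finset ℤ, ∑ k ∈ S, c k * ∫ ξ, w k ξ ≤ 2 * Real.pi * A.toReal ^ 2 := by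
    intro S
    refine (ENNReal.ofReal_le_ofReal_iff (by positivity)).1 ?_
    rw [ENNReal.ofReal_sum_of_nonneg fun k _ => mul_nonneg (hc k).le
      (integral_nonneg fun ξ => by positivity)]
    calc ∑ k ∈ S, ENNReal.ofReal (c k * ∫ ξ, w k ξ)
        = ∑ k ∈ S, ∫⁻ ξ, ENNReal.ofReal (c k * w k ξ) := by
          refine Finset.sum_congr rfl fun k _ => ?_
          rw [← integral_const_mul, ofReal_integral_eq_lintegral_ofReal ((hw k).const_mul _)
            (Filter.Eventually.of_forall fun ξ => mul_nonneg (hc k).le (by positivity))]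
      _ ≤ ∑ k ∈ S, ENNReal.ofReal (2 * Real.pi) * T k := Finset.sum_le_sum fun k _ => hle k
      _ ≤ ENNReal.ofReal (2 * Real.pi) * A ^ 2 := by
          rw [← Finset.mul_sum]
          gcongr
          exact hTS S
      _ = _ := by
          rw [ENNReal.ofReal_mul hpi.le, ENNReal.ofReal_pow ENNReal.toReal_nonneg,
            ENNReal.ofReal_toReal hA]
  have hX : ENNReal.ofReal (C * √(2 ^ (2 * b) * (2 * Real.pi))) * A =
      ENNReal.ofReal (C * √(2 ^ (2 * b) * (2 * Real.pi)) * A.toReal) := by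
    rw [ENNReal.ofReal_mul (q := A.toReal) (by positivity), ENNReal.ofReal_toReal hA]
  rw [hX]
  refine eLpNorm_six_le_of_modeSum hv (G := fun k => 𝓕⁻ (g k))
    (fun k => continuous_fourierInv (hgi k)) (fun k => spaceCoeff_ae_eq hv k (hgi k)) fun S => ?_
  let ψ : ℤ → ℝ := fun k => phase α β k
  let F : ℤ → ℤ → ℝ → ℂ := fun m k => 𝓕⁻ (blockPart (g k) (ψ k) m)
  let e : ℤ → ℤ → ℝ := fun m k => ∫ ξ, ‖blockPart (g k) (ψ k) m ξ‖ ^ 2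
  have hF : ∀ m : ℤ, WavePackets (fun k => ψ k + m) (F m) (e m) := fun m =>
    wavePackets_blockPart hgi hg2 m
  have hlim : ∀ z, Filter.Tendsto (fun M : Finset ℤ => ∑ m ∈ M, modeSum (F m) S z)
      Filter.atTop (nhds (modeSum (fun k => 𝓕⁻ (g k)) S z)) := by
    intro z
    have h1 : HasSum (fun m => modeSum (F m) S z) (modeSum (fun k => 𝓕⁻ (g k)) S z) :=
      hasSum_sum fun k _ => (hasSum_fourierInv_blockPart (hgi k) (ψ k) z.2).mul_left _
    exact h1
  obtain ⟨M, hM⟩ := Filter.exists_seq_tendsto (Filter.atTop : Filter (Finset ℤ))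
  -- Only finitely many `m` are allowed in the packet estimate, whose bound does not depend on their
  -- number; Fatou passes to all `m`.
  refine (Lp.eLpNorm_lim_le_liminf_eLpNorm (fun n => ?_) _
    (Filter.Eventually.of_forall fun z => (hlim z).comp hM)).trans
    (Filter.liminf_le_of_frequently_le' (Filter.Frequently.of_forall fun n => ?_))
  · exact (continuous_finsetSum _ fun m _ => (hF m).continuous_modeSum S).aestronglyMeasurable
  refine (hbound F e hF (M n) S).trans (ENNReal.ofReal_le_ofReal ?_)
  rw [mul_assoc]
  refine mul_le_mul_of_nonneg_left ?_ hC
  rw [← Real.sqrt_sq (ENNReal.toReal_nonneg (a := A)), ← Real.sqrt_mul (by positivity)]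
  refine Real.sqrt_le_sqrt ?_
  calc ∑ m ∈ M n, (1 + |(m : ℝ)|) ^ (2 * b) * ∑ k ∈ S, c k * e m k
      = ∑ k ∈ S, c k * ∑ m ∈ M n, (1 + |(m : ℝ)|) ^ (2 * b) * e m k := by
        simp only [Finset.mul_sum]
        rw [Finset.sum_comm]
        exact Finset.sum_congr rfl fun k _ => Finset.sum_congr rfl fun m _ => by ring
    _ ≤ ∑ k ∈ S, c k * (2 ^ (2 * b) * ∫ ξ, w k ξ) := by
        gcongr with k
        exact sum_blockPart_energy_le (by linarith) (hg2 k) (hw k) (M n)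
    _ = 2 ^ (2 * b) * ∑ k ∈ S, c k * ∫ ξ, w k ξ := by
        rw [Finset.mul_sum]
        exact Finset.sum_congr rfl fun k _ => by ring
    _ ≤ 2 ^ (2 * b) * (2 * Real.pi * A.toReal ^ 2) := by
        gcongr
        exact henergy S
    _ = _ := by ring

end Kawahara

end

theorem lemma4p3 (α β : ℝ) (hα : α ≠ 0) (ε : ℝ) (hε : 0 < ε) (b : ℝ) (hb : 1 / 2 < b) :
    ∃ C : ℝ≥0, ∀ δ : ℝ, 0 ≤ δ → ∀ u : Kawahara.Torus × ℝ → ℂ,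
      eLpNorm ((Prod.snd ⁻¹' Set.Icc (0 : ℝ) δ).indicator u) 6 volume ≤
        C * Kawahara.restrictedNorm α β ε b δ u := by
  obtain ⟨C, hC, hbound⟩ := Kawahara.eLpNorm_six_le_bourgainNorm α β hα hε hb
  -- `C` may be `0`; with `C + 1` the constant moves through the infima and its product with an
  -- infinite norm is `∞`.
  have hC1 : ENNReal.ofReal (C + 1) ≠ 0 := (ENNReal.ofReal_pos.2 (by linarith)).ne'
  refine ⟨(C + 1).toNNReal, fun δ _ u => ?_⟩
  change _ ≤ ENNReal.ofReal (C + 1) * _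
  rw [Kawahara.restrictedNorm, ENNReal.mul_iInf_of_ne hC1 ENNReal.ofReal_ne_top]
  refine le_iInf fun v => ?_
  rw [ENNReal.mul_iInf_of_ne hC1 ENNReal.ofReal_ne_top]
  refine le_iInf fun huv => ?_
  by_cases hA : Kawahara.bourgainNorm α β ε b v = ∞
  · rw [hA, ENNReal.mul_top hC1]
    exact le_top
  have hv : MemLp v 2 volume := by
    by_contra hv
    exact hA (by rw [Kawahara.bourgainNorm, dif_neg hv])
  have hae : (Prod.snd ⁻¹' Set.Icc (0 : ℝ) δ).indicator u =ᵐ[volume]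
      (Prod.snd ⁻¹' Set.Icc (0 : ℝ) δ).indicator v := by
    filter_upwards [huv] with z hz
    by_cases hzm : z ∈ Prod.snd ⁻¹' Set.Icc (0 : ℝ) δ
    · rw [Set.indicator_of_mem hzm, Set.indicator_of_mem hzm, hz hzm]
    · rw [Set.indicator_of_notMem hzm, Set.indicator_of_notMem hzm]
  rw [eLpNorm_congr_ae hae]
  refine (eLpNorm_indicator_le v).trans ((hbound v hv hA).trans ?_)
  gcongr
  linarith
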